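/- Let $p$ be a prime, let $G=\mathbb{F}_p^{(\omega)}$ be the group of finitely supported sequences in $\mathbb{F}_p$, and let $\mathcal{M}=(G,\mathbb{F}_p,0,+,\cdot)$ be the two-sorted structure in which $0$ is the neutral element of $G$, $+$ is the addition of $G$, and $\cdot\colon G\times G\to\mathbb{F}_p$ is the bilinear form $(a_i)_i\cdot(b_i)_i=\sum_i a_ib_i$. Let $T$ be the complete first-order theory of $\mathcal{M}$. A formula $\psi(\bar y_0,\dots,\bar y_{n-1};\bar x)$ has the $n$-independence property in $T$ if in some model $N$ of $T$ there are tuples $\bar a^j_i$ ($i\in\omega$, $j<n$) and $\bar b_I$ ($I\subseteq\omega^n$) such that $N\models\psi(\bar a^0_{i_0},\dots,\bar a^{n-1}_{i_{n-1}};\bar b_I)$ if and only if $(i_0,\dots,i_{n-1})\in I$. The theory $T$ is $n$-dependent if no formula has the $n$-independence property in $T$; the independence property is the $1$-independence property. The theory $T$ is simple if no formula has the tree property in $T$. For a model $N$ of $T$ and a set $A$ of elements of $N$, let $G^0_A(N)$ be the intersection of all $A$-definable subgroups of finite index of $G(N)$, and let $G^{00}_A(N)$ be the intersection of all subgroups of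 bounded index of $G(N)$ that are type-definable over $A$. Here a partial type over $A$ defines a type-definable subgroup of bounded index if in every elementary extension of $N$ its solution set is a subgroup of $G$ whose index is at most a cardinal that does not depend on the extension. Then the following hold. 1. $T$ is $2$-dependent. 2. $T$ is simple. 3. $T$ has the independence property. 4. $G$ has no absolute connected component: it is not the case that $G^0_A(N)=G^0_\emptyset(N)$ for all models $N$ of $T$ and all $A\subseteq N$, and it is not the case that $G^{00}_A(N)=G^{00}_\emptyset(N)$ for all such $N$ and $A$. 5. There is no minimal type-definable subgroup of bounded index: for every model $N$ of $T$ and every type-definable subgroup $H$ of bounded index of $G$, over parameters from $N$, there are an elementary extension $N'$ of $N$ and a type-definable subgroup of bounded index, over parameters from $N'$, whose set of points in $N'$ is properly contained in $H(N')$. -/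

import Mathlib

open scoped FirstOrder

/-! ### Dividing lines for first-order theories -/

namespace ModelDividing

universe u v

variable {L : FirstOrder.Language.{u, v}}

/-- The formula `ψ(ȳ₀, …, ȳₙ₋₁; x̄)`, with `|ȳⱼ| = k j` and `|x̄| = m`, has the `n`-independence
property in `T`: in some model there are tuples `a j i` (`j < n`, `i ∈ ω`) and `b I` (`I ⊆ ωⁿ`) with
`ψ(a 0 (i 0), …, a (n-1) (i (n-1)); b I)` if and only if `i ∈ I`. -/
def FormulaHasIP (T : L.Theory) {n : ℕ} {k : Fin n → ℕ} {m : ℕ}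
    (ψ : L.Formula ((Σ j : Fin n, Fin (k j)) ⊕ Fin m)) : Prop :=
  ∃ (N : FirstOrder.Language.Theory.ModelType.{u, v, max u v} T)
    (a : (j : Fin n) → ℕ → Fin (k j) → N) (b : Set (Fin n → ℕ) → Fin m → N),
    ∀ (I : Set (Fin n → ℕ)) (i : Fin n → ℕ),
      ψ.Realize (Sum.elim (fun y => a y.1 (i y.1) y.2) (b I)) ↔ i ∈ I

/-- `T` has the `n`-independence property. For `n = 1` this is the independence property. -/
def HasIP (n : ℕ) (T : L.Theory) : Prop :=
  ∃ (k : Fin n → ℕ) (m : ℕ) (ψ : L.Formula ((Σ j : Fin n, Fin (k j)) ⊕ Fin m)), FormulaHasIP T ψ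

/-- `T` is `n`-dependent. -/
def IsDependent (n : ℕ) (T : L.Theory) : Prop := ¬ HasIP n T

/-- The formula `φ(x̄; ȳ)` has the tree property in `T`: in some model there are a number `k ≥ 2`
and a tree of tuples `a s`, `s ∈ ω^{<ω}`, such that the formulas `φ(x̄; a s)` along each branch `σ`
are (finitely) consistent, while at each node `s` the formulas `φ(x̄; a (s⌢i))`, `i ∈ ω`, are
`k`-inconsistent. -/
def FormulaHasTP (T : L.Theory) {m l : ℕ} (φ : L.Formula (Fin m ⊕ Fin l)) : Prop :=
  ∃ (N : FirstOrder.Language.Theory.ModelType.{u, v, max u v} T) (k : ℕ) (a : List ℕ → Fin l → N),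
    2 ≤ k ∧
    (∀ (σ : ℕ → ℕ) (d : ℕ), ∃ x : Fin m → N, ∀ e < d,
      φ.Realize (Sum.elim x (a (List.ofFn fun i : Fin (e + 1) => σ i)))) ∧
    (∀ (s : List ℕ) (J : Finset ℕ), J.card = k →
      ¬ ∃ x : Fin m → N, ∀ i ∈ J, φ.Realize (Sum.elim x (a (s ++ [i]))))

/-- `T` is simple: no formula has the tree property. -/
def IsSimpleTheory (T : L.Theory) : Prop :=
  ∀ (m l : ℕ) (φ : L.Formula (Fin m ⊕ Fin l)), ¬ FormulaHasTP T φ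

end ModelDividing

/-! ### The two-sorted structure `(𝔽_p^(ω), 𝔽_p, 0, +, ·)` -/

namespace BilinearSpace

/-- The constant symbol `0`. -/
inductive Func : ℕ → Type
  | zero : Func 0

/-- The two sorts, and the graphs of addition and of the bilinear form. -/
inductive Rel : ℕ → Type
  | vec : Rel 1
  | scal : Rel 1
  | add : Rel 3
  | dot : Rel 3

/-- The language of `(V, F, 0, +, ·)`, with the two sorts given as unary predicates. -/
def lang : FirstOrder.Language.{0, 0} := ⟨Func, Rel⟩

/-- The disjoint union of the sorts `𝔽_p^(ω)` and `𝔽_p`. -/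
inductive Carrier (p : ℕ) : Type
  | vec (x : ℕ →₀ ZMod p) : Carrier p
  | scal (c : ZMod p) : Carrier p

/-- The bilinear form `x · y = ∑ᵢ xᵢ yᵢ`. -/
def form {p : ℕ} (x y : ℕ →₀ ZMod p) : ZMod p := ∑ i ∈ x.support, x i * y i

instance instStructure (p : ℕ) : lang.Structure (Carrier p) where
  funMap := fun {_} f _ => match f with
    | Func.zero => Carrier.vec 0
  RelMap := fun {_} r => match r with
    | Rel.vec => fun t => ∃ x, t 0 = Carrier.vec x
    | Rel.scal => fun t => ∃ c, t 0 = Carrier.scal c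
    | Rel.add => fun t => ∃ x y, t 0 = Carrier.vec x ∧ t 1 = Carrier.vec y ∧
        t 2 = Carrier.vec (x + y)
    | Rel.dot => fun t => ∃ x y, t 0 = Carrier.vec x ∧ t 1 = Carrier.vec y ∧
        t 2 = Carrier.scal (form x y)

/-- The complete theory of `(𝔽_p^(ω), 𝔽_p, 0, +, ·)`. -/
def theory (p : ℕ) : lang.Theory := lang.completeTheory (Carrier p)

/-! ### Subgroups of the vector sort and connected components -/

section Group

variable {N : Type} [lang.Structure N]

/-- `x` belongs to the group `G(N)`, the vector sort of `N`. -/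
def IsVec (x : N) : Prop := FirstOrder.Language.Structure.RelMap (L := lang) Rel.vec ![x]

/-- `x + y = z` in `G(N)`. -/
def IsAdd (x y z : N) : Prop := FirstOrder.Language.Structure.RelMap (L := lang) Rel.add ![x, y, z]

/-- The neutral element of `G(N)`. -/
def zeroVec (N : Type) [lang.Structure N] : N := FirstOrder.Language.Structure.funMap (L := lang) Func.zero ![]

/-- `H` is a subgroup of `G(N)`. -/
def IsSubgroup (H : Set N) : Prop :=
  (∀ x ∈ H, IsVec x) ∧ zeroVec N ∈ H ∧
    (∀ x ∈ H, ∀ y ∈ H, ∀ z, IsAdd x y z → z ∈ H) ∧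
    (∀ x ∈ H, ∀ y, IsAdd x y (zeroVec N) → y ∈ H)

/-- The set of cosets `g + H`, `g ∈ G(N)`; its cardinality is the index of `H` in `G(N)`. -/
def cosets (H : Set N) : Set (Set N) :=
  {C | ∃ g : N, IsVec g ∧ C = {z | ∃ h ∈ H, IsAdd g h z}}

/-- `G⁰_A(N)`: the intersection of all `A`-definable subgroups of `G(N)` of finite index. -/
def finComponent (A : Set N) : Set N :=
  ⋂₀ {H | A.Definable₁ lang H ∧ IsSubgroup H ∧ (cosets H).Finite}

/-- The set of solutions in `N'` of the partial type `π(x)` over `A`, where the parameters from `A`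
are interpreted in `N'` by `f`. -/
def solutions {A : Set N} (π : Set (lang.Formula (A ⊕ Unit))) {N' : Type} [lang.Structure N']
    (f : N → N') : Set N' :=
  {x | ∀ φ ∈ π, φ.Realize (Sum.elim (fun a : A => f a) fun _ => x)}

/-- The partial type `π(x)` over `A ⊆ N` defines a type-definable subgroup of bounded index of `G`:
in all elementary extensions of `N` its solutions form a subgroup, and the index of this subgroup
is bounded by a cardinal that does not depend on the extension. -/
def IsBoundedSubgroup {A : Set N} (π : Set (lang.Formula (A ⊕ Unit))) : Prop :=
  ∃ κ : Cardinal.{0}, ∀ (N' : Type) [lang.Structure N'] (f : N ↪ₑ[lang] N'),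
    IsSubgroup (solutions π f) ∧ Cardinal.mk (cosets (solutions π f)) ≤ κ

/-- `G⁰⁰_A(N)`: the intersection of all subgroups of bounded index that are type-definable
over `A`. -/
def bddComponent (A : Set N) : Set N :=
  {x | ∀ π : Set (lang.Formula (A ⊕ Unit)), IsBoundedSubgroup π → x ∈ solutions π (id : N → N)}

end Group

/-- The absolute connected component for definable subgroups of finite index exists:
`G⁰_A` does not depend on the parameter set `A`. -/
def HasAbsoluteFinComponent (T : lang.Theory) : Prop :=
  ∀ (N : Type) [lang.Structure N] [N ⊨ T] (A : Set N), finComponent A = finComponent (∅ : Set N)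

/-- The absolute connected component for type-definable subgroups of bounded index exists:
`G⁰⁰_A` does not depend on the parameter set `A`. -/
def HasAbsoluteBddComponent (T : lang.Theory) : Prop :=
  ∀ (N : Type) [lang.Structure N] [N ⊨ T] (A : Set N), bddComponent A = bddComponent (∅ : Set N)

/-- There is a type-definable subgroup of bounded index (given by a partial type `π` over `A ⊆ N`)
that is minimal: it properly contains no type-definable subgroup of bounded index, over parameters
from any elementary extension. -/
def HasMinimalBddSubgroup (T : lang.Theory) : Prop :=
  ∃ (N : Type) (_ : lang.Structure N) (_ : N ⊨ T) (A : Set N) (π : Set (lang.Formula (A ⊕ Unit))),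
    IsBoundedSubgroup π ∧
    ∀ (N' : Type) [lang.Structure N'] (f : N ↪ₑ[lang] N') (B : Set N')
      (ρ : Set (lang.Formula (B ⊕ Unit))), IsBoundedSubgroup ρ →
      solutions ρ (id : N' → N') ⊆ solutions π f → solutions ρ (id : N' → N') = solutions π f

end BilinearSpace

/-!
Every model of the theory is the disjoint union of `𝔽_p` and a space `V` over `𝔽_p` with a symmetric
bilinear form in which every functional on a finitely generated subspace is represented by vectors
outside it of any prescribed norm. This extension property drives a back-and-forth: the type of a
tuple is determined by the sorts of its entries, the values of its scalars, and the linear relations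
and inner products of its vectors.

* Two-dependence is a count: a tuple has only `exp(O(n))` types over `n` parameters, whereas the
  `2`-independence property would separate `2 ^ n²` tuples over `O(n)` parameters.
* For simplicity, consider the linear relations between a solution of the formulas along a branch
  and the parameters on it. Their rank is bounded, so at some node infinitely many children add no
  new relation. Any finite number of these children can be chosen as a sunflower, over which the
  inner products with the respective solutions glue to functionals; a generic tuple representing
  them solves all the chosen formulas.
* The form has the independence property because in an ultrapower some vector takes the inner
  products `0` and `1` with the basis vectors in any prescribed pattern.
* In a large model, a subgroup of bounded index that is type-definable over `∅` contains a nonzero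
  vector `x`, hence every nonzero vector `y` of the same norm. For a suitable `y` the difference
  `x - y` is isotropic, and so the subgroup contains every isotropic vector. But `b^⊥` has finite
  index, and for every nonzero vector some `b` excludes it from `b^⊥`; adding `b` to the parameters
  therefore shrinks the components and every subgroup of bounded index.
-/

namespace ModelDividing

section Elementary

open FirstOrder.Language

universe u v w

variable {L : FirstOrder.Language.{u, v}}

/-- The property `P` of `α`-tuples in `L`-structures is expressed by a single formula. -/
def IsElementary (L : FirstOrder.Language.{u, v}) {α : Type*}
    (P : ∀ (K : Type w) [L.Structure K], (α → K) → Prop) : Prop :=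
  ∃ φ : L.Formula α, ∀ (K : Type w) [L.Structure K] (v : α → K), φ.Realize v ↔ P K v

namespace IsElementary

variable {α : Type*} {P Q : ∀ (K : Type w) [L.Structure K], (α → K) → Prop}

theorem const (q : Prop) : IsElementary.{u, v, w} L (α := α) fun _ _ _ => q := by
  by_cases hq : q
  · exact ⟨⊤, fun _ _ _ => iff_of_true (BoundedFormula.realize_top.2 trivial) hq⟩
  · exact ⟨⊥, fun _ _ _ => iff_of_false (fun h => BoundedFormula.realize_bot.1 h) hq⟩

theorem eq (a b : α) : IsElementary.{u, v, w} L fun _ _ v => v a = v b :=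
  ⟨Term.equal (Term.var a) (Term.var b), fun _ _ v => by simp⟩

theorem rel {n : ℕ} (r : L.Relations n) (t : Fin n → α) :
    IsElementary.{u, v, w} L fun K _ v => Structure.RelMap (M := K) r fun i => v (t i) :=
  ⟨r.formula fun i => Term.var (t i), fun _ _ _ => Formula.realize_rel⟩

theorem not (hP : IsElementary L P) : IsElementary L fun K _ v => ¬ P K v := by
  obtain ⟨φ, hφ⟩ := hP
  exact ⟨φ.not, fun K _ v => by rw [Formula.realize_not, hφ]⟩

theorem and (hP : IsElementary L P) (hQ : IsElementary L Q) :
    IsElementary L fun K _ v => P K v ∧ Q K v := by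
  obtain ⟨φ, hφ⟩ := hP
  obtain ⟨ψ, hψ⟩ := hQ
  exact ⟨φ ⊓ ψ, fun K _ v => by rw [Formula.realize_inf, hφ, hψ]⟩

theorem imp (hP : IsElementary L P) (hQ : IsElementary L Q) :
    IsElementary L fun K _ v => P K v → Q K v := by
  obtain ⟨φ, hφ⟩ := hP
  obtain ⟨ψ, hψ⟩ := hQ
  exact ⟨φ.imp ψ, fun K _ v => by rw [Formula.realize_imp, hφ, hψ]⟩

theorem iff (hP : IsElementary L P) (hQ : IsElementary L Q) :
    IsElementary L fun K _ v => P K v ↔ Q K v := by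
  obtain ⟨φ, hφ⟩ := hP
  obtain ⟨ψ, hψ⟩ := hQ
  exact ⟨φ.iff ψ, fun K _ v => by rw [Formula.realize_iff, hφ, hψ]⟩

theorem forall_finite {ι : Type*} [Finite ι]
    {P : ι → ∀ (K : Type w) [L.Structure K], (α → K) → Prop} (hP : ∀ i, IsElementary L (P i)) :
    IsElementary L fun K _ v => ∀ i, P i K v := by
  choose φ hφ using hP
  exact ⟨Formula.iInf φ, fun K _ v => by
    rw [Formula.realize_iInf]
    exact forall_congr' fun i => hφ i K v⟩

theorem exists_finite {ι : Type*} [Finite ι]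
    {P : ι → ∀ (K : Type w) [L.Structure K], (α → K) → Prop} (hP : ∀ i, IsElementary L (P i)) :
    IsElementary L fun K _ v => ∃ i, P i K v := by
  choose φ hφ using hP
  exact ⟨Formula.iSup φ, fun K _ v => by
    rw [Formula.realize_iSup]
    exact exists_congr fun i => hφ i K v⟩

theorem forall_tuple {β : Type*} [Finite β]
    {P : ∀ (K : Type w) [L.Structure K], (α → K) → (β → K) → Prop}
    (hP : IsElementary L (α := α ⊕ β) fun K _ v => P K (v ∘ .inl) (v ∘ .inr)) :
    IsElementary L fun K _ v => ∀ x : β → K, P K v x := by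
  obtain ⟨φ, hφ⟩ := hP
  exact ⟨Formula.iAlls β φ, fun K _ v => by
    rw [Formula.realize_iAlls]
    exact forall_congr' fun x => hφ K _⟩

theorem all {P : ∀ (K : Type w) [L.Structure K], (α → K) → K → Prop}
    (hP : IsElementary L (α := α ⊕ Unit) fun K _ v => P K (v ∘ .inl) (v (.inr ()))) :
    IsElementary L fun K _ v => ∀ x : K, P K v x := by
  obtain ⟨φ, hφ⟩ := hP
  exact ⟨Formula.iAlls Unit φ, fun K _ v => by
    rw [Formula.realize_iAlls]
    exact ⟨fun h x => (hφ K _).1 (h fun _ => x), fun h x => (hφ K _).2 (h (x ()))⟩⟩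

theorem ex {P : ∀ (K : Type w) [L.Structure K], (α → K) → K → Prop}
    (hP : IsElementary L (α := α ⊕ Unit) fun K _ v => P K (v ∘ .inl) (v (.inr ()))) :
    IsElementary L fun K _ v => ∃ x : K, P K v x := by
  obtain ⟨φ, hφ⟩ := hP
  exact ⟨Formula.iExs Unit φ, fun K _ v => by
    rw [Formula.realize_iExs]
    exact ⟨fun ⟨x, h⟩ => ⟨x (), (hφ K _).1 h⟩, fun ⟨x, h⟩ => ⟨fun _ => x, (hφ K _).2 h⟩⟩⟩

variable {M N : Type w} [L.Structure M] [L.Structure N]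

theorem iff_of_elementaryEmbedding (hP : IsElementary L P) (f : M ↪ₑ[L] N) (v : α → M) :
    P N (f ∘ v) ↔ P M v := by
  obtain ⟨φ, hφ⟩ := hP
  rw [← hφ, ← hφ, f.map_formula]

theorem exists_of_completeTheory [Finite α] [N ⊨ L.completeTheory M] (hP : IsElementary L P)
    {v : α → M} (hv : P M v) : ∃ w, P N w := by
  obtain ⟨φ, hφ⟩ := hP
  let σ : L.Sentence := Formula.iExs α (φ.relabel Sum.inr : L.Formula (Empty ⊕ α))
  have hσ : ∀ (K : Type w) [L.Structure K], K ⊨ σ ↔ ∃ v, P K v := fun K _ => by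
    simp only [σ, Sentence.Realize]
    rw [Formula.realize_iExs]
    exact exists_congr fun v => by
      rw [Formula.realize_relabel, ← hφ]
      rfl
  exact (hσ N).1 ((realize_iff_of_model_completeTheory M N σ).2 ((hσ M).2 ⟨v, hv⟩))

/- If no solution of `P` in `N` works, the finitely many properties witnessing this can be added
to `P`, contradicting elementary equivalence. -/
theorem exists_same_type [Finite α] [N ⊨ L.completeTheory M] (hP : IsElementary L P) {v : α → M}
    (h : P M v) (hfin : {w : α → N | P N w}.Finite) :
    ∃ w, P N w ∧ ∀ Q : ∀ (K : Type w) [L.Structure K], (α → K) → Prop,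
      IsElementary L Q → Q M v → Q N w := by
  by_contra! hcon
  have : Finite {w : α → N | P N w} := hfin
  choose Q hQ hQM hQN using fun w : {w : α → N | P N w} => hcon w w.2
  obtain ⟨w, hw, hw'⟩ := exists_of_completeTheory (N := N) (hP.and (forall_finite hQ))
    ⟨h, fun w => hQM w⟩
  exact hQN ⟨w, hw⟩ (hw' ⟨w, hw⟩)

end IsElementary

end Elementary

theorem FormulaHasIP.exists_injective_type.{u, v} {L : FirstOrder.Language.{u, v}} {T : L.Theory}
    {d m : ℕ} {k : Fin d → ℕ} {ψ : L.Formula ((Σ j : Fin d, Fin (k j)) ⊕ Fin m)}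
    (h : FormulaHasIP T ψ) : ∃ N : FirstOrder.Language.Theory.ModelType.{u, v, max u v} T,
      ∀ n : ℕ, ∃ (g : (Σ j : Fin d, Fin n × Fin (k j)) → N) (b : Set (Fin d → Fin n) → Fin m → N),
        Function.Injective fun t => {φ : L.Formula _ | φ.Realize (Sum.elim g (b t))} := by
  obtain ⟨N, a, b, hab⟩ := h
  refine ⟨N, fun n => ⟨fun y => a y.1 y.2.1 y.2.2,
    fun t => b ((fun i j => (i j : ℕ)) '' t), fun t t' htt' => Set.ext fun i => ?_⟩⟩
  have hval : Function.Injective fun (i : Fin d → Fin n) (j : Fin d) => (i j : ℕ) :=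
    Fin.val_injective.comp_left
  let φ : L.Formula ((Σ j : Fin d, Fin n × Fin (k j)) ⊕ Fin m) :=
    ψ.relabel (Sum.map (fun y => ⟨y.1, i y.1, y.2⟩) id)
  have hφ (t : Set (Fin d → Fin n)) : φ.Realize
      (Sum.elim (fun y => a y.1 y.2.1 y.2.2) (b ((fun i j => (i j : ℕ)) '' t))) ↔ i ∈ t := by
    rw [← hval.mem_set_image, ← hab, FirstOrder.Language.Formula.realize_relabel,
      Sum.elim_comp_map]
    rfl
  rw [← hφ t, ← hφ t']
  exact Set.ext_iff.1 htt' φ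

theorem exists_branch {G : List ℕ → ℕ → Prop} (hG : ∀ s, {i | G s i}.Finite) :
    ∃ σ : ℕ → ℕ, ∀ e, ¬ G (List.ofFn fun i : Fin e => σ i) (σ e) := by
  choose next hnext using fun s => (hG s).exists_notMem
  let node (e : ℕ) : List ℕ := Nat.rec [] (fun _ s => s ++ [next s]) e
  have hnode (e : ℕ) : List.ofFn (fun i : Fin e => next (node i)) = node e := by
    induction e with
    | zero => rfl
    | succ e ih => simp only [List.ofFn_succ_last, Fin.val_castSucc, ih, Fin.val_last, node]
  exact ⟨fun e => next (node e), fun e => (hnode e).symm ▸ hnext (node e)⟩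

/- Otherwise some branch leaves the stable children at every node, and the rank of a common solution
along it grows beyond `m`. -/
theorem exists_infinite_stable_children {X : Type*} {Φ : X → List ℕ → Prop} {r : X → List ℕ → ℕ}
    {m : ℕ} (hr : ∀ x s, r x s ≤ m)
    (hΦ : ∀ (σ : ℕ → ℕ) (d : ℕ), ∃ x, ∀ e < d, Φ x (List.ofFn fun i : Fin (e + 1) => σ i)) :
    ∃ s, ∃ I : Set ℕ, I.Infinite ∧ ∀ i ∈ I, ∃ x, Φ x (s ++ [i]) ∧ r x (s ++ [i]) ≤ r x s := by
  suffices h : ∃ s, {i | ∃ x, Φ x (s ++ [i]) ∧ r x (s ++ [i]) ≤ r x s}.Infinite from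
    h.imp fun s hs => ⟨_, hs, fun _ => id⟩
  by_contra! hfin
  obtain ⟨σ, hσ⟩ := exists_branch hfin
  obtain ⟨x, hx⟩ := hΦ σ (m + 1)
  have hrank : ∀ e ≤ m + 1, e ≤ r x (List.ofFn fun i : Fin e => σ i) := by
    intro e he
    induction e with
    | zero => exact Nat.zero_le _
    | succ e ih =>
      have hsucc : (List.ofFn fun i : Fin (e + 1) => σ i) =
          (List.ofFn fun i : Fin e => σ i) ++ [σ e] := by
        simp only [List.ofFn_succ_last, Fin.val_castSucc, Fin.val_last]
      refine (ih (by omega)).trans_lt (not_le.1 fun hle => hσ e ⟨x, ?_, ?_⟩)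
      · exact hsucc ▸ hx e he
      · exact hsucc ▸ hle
  exact absurd ((hrank (m + 1) le_rfl).trans (hr x _)) (by omega)

open FirstOrder.Language Filter in
theorem FormulaHasIP.of_eventually.{u, v} {L : FirstOrder.Language.{u, v}} {M : Type (max u v)}
    [L.Structure M] [Nonempty M] {d m : ℕ} {k : Fin d → ℕ}
    {ψ : L.Formula ((Σ j : Fin d, Fin (k j)) ⊕ Fin m)} (a : (j : Fin d) → ℕ → Fin (k j) → M)
    (b : Set (Fin d → ℕ) → ℕ → Fin m → M)
    (h : ∀ (I : Set (Fin d → ℕ)) (i : Fin d → ℕ), ∀ᶠ n in atTop,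
      (ψ.Realize (Sum.elim (fun y => a y.1 (i y.1) y.2) (b I n)) ↔ i ∈ I)) :
    FormulaHasIP (L.completeTheory M) ψ := by
  let U := hyperfilter ℕ
  let N := (U : Filter ℕ).Product fun _ => M
  let cls (x : ℕ → M) : N := Quotient.mk ((U : Filter ℕ).productSetoid fun _ => M) x
  have hN : N ⊨ L.completeTheory M := ⟨fun σ hσ =>
    (Ultraproduct.sentence_realize (M := fun _ => M) σ).2 (Eventually.of_forall fun _ => hσ)⟩
  refine ⟨Theory.ModelType.of _ N, fun j i y => cls fun _ => a j i y,
    fun I l => cls fun n => b I n l, fun I i => ?_⟩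
  let w : (Σ j : Fin d, Fin (k j)) ⊕ Fin m → ℕ → M :=
    Sum.elim (fun y _ => a y.1 (i y.1) y.2) fun l n => b I n l
  have hw : Sum.elim (fun y => cls fun _ => a y.1 (i y.1) y.2) (fun l => cls fun n => b I n l) =
      fun y => cls (w y) := by
    funext y
    cases y <;> rfl
  have hwn (n : ℕ) : Sum.elim (fun y => a y.1 (i y.1) y.2) (b I n) = fun y => w y n := by
    funext y
    cases y <;> rfl
  have hwI : ∀ᶠ n in atTop, ((ψ.Realize fun y => w y n) ↔ i ∈ I) :=
    (h I i).mono fun n hn => hwn n ▸ hn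
  calc ψ.Realize (M := N) _ ↔ ψ.Realize fun y => cls (w y) := iff_of_eq (congrArg _ hw)
    _ ↔ ∀ᶠ n in (U : Filter ℕ), ψ.Realize fun y => w y n := Ultraproduct.realize_formula_cast ψ w
    _ ↔ ∀ᶠ _ in (U : Filter ℕ), i ∈ I := eventually_congr (Nat.hyperfilter_le_atTop hwI)
    _ ↔ i ∈ I := eventually_const

end ModelDividing

namespace BilinearSpace

section LinearAlgebra

/-- Every functional on a finitely generated submodule is represented by a vector outside of it
whose value under the quadratic form is prescribed. -/
def ExtensionProperty {F V : Type*} [CommRing F] [AddCommGroup V] [Module F V]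
    (B : V →ₗ[F] V →ₗ[F] F) : Prop :=
  ∀ D : Submodule F V, D.FG → ∀ (l : V →ₗ[F] F) (c : F),
    ∃ y, y ∉ D ∧ (∀ d ∈ D, B y d = l d) ∧ B y y = c

/-- A finitely generated partial isometry between `(U, Q)` and `(V, B)`, given by its graph. -/
structure IsPartialIsometry {F U V : Type*} [CommRing F] [AddCommGroup U] [Module F U]
    [AddCommGroup V] [Module F V] (Q : U →ₗ[F] U →ₗ[F] F) (B : V →ₗ[F] V →ₗ[F] F)
    (S : Submodule F (U × V)) : Prop where
  fg : S.FG
  isometry : ∀ s ∈ S, ∀ t ∈ S, Q s.1 t.1 = B s.2 t.2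
  snd_eq_zero : ∀ s ∈ S, s.1 = 0 → s.2 = 0
  fst_eq_zero : ∀ s ∈ S, s.2 = 0 → s.1 = 0

/-- The tuples `x` and `x'`, given by linear maps from a common module of formal linear
combinations, satisfy the same linear relations over `A` and have the same products among
themselves and with `A`. -/
structure SameTypeOver {F E V : Type*} [CommRing F] [AddCommGroup E] [Module F E]
    [AddCommGroup V] [Module F V] (B : V →ₗ[F] V →ₗ[F] F) (A : Submodule F V)
    (x x' : E →ₗ[F] V) : Prop where
  gram : ∀ e e', B (x e) (x e') = B (x' e) (x' e')
  inner : ∀ e, ∀ c ∈ A, B (x e) c = B (x' e) c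
  relation : ∀ e, ∀ c ∈ A, x e = c ↔ x' e = c

variable {F E U V W : Type*} [Field F] [AddCommGroup E] [Module F E] [AddCommGroup U] [Module F U]
  [AddCommGroup V] [Module F V] [AddCommGroup W] [Module F W]

theorem exists_comp_eq_of_ker_le {g : U →ₗ[F] W} {h : U →ₗ[F] V}
    (hgh : LinearMap.ker h ≤ LinearMap.ker g) : ∃ l : V →ₗ[F] W, l ∘ₗ h = g := by
  obtain ⟨l, hl⟩ := LinearMap.exists_extend
    ((LinearMap.ker h).liftQ g hgh ∘ₗ h.quotKerEquivRange.symm.toLinearMap)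
  refine ⟨l, LinearMap.ext fun u => ?_⟩
  have hu : h.quotKerEquivRange.symm ⟨h u, LinearMap.mem_range_self h u⟩
      = Submodule.Quotient.mk u := (LinearEquiv.symm_apply_eq _).2 rfl
  simpa [hu] using LinearMap.congr_fun hl ⟨h u, LinearMap.mem_range_self h u⟩

theorem exists_glue (f g : V →ₗ[F] W) (C D : Submodule F V) (h : ∀ x ∈ C, x ∈ D → f x = g x) :
    ∃ l : V →ₗ[F] W, (∀ x ∈ C, l x = f x) ∧ ∀ x ∈ D, l x = g x := by
  obtain ⟨l, hl⟩ := exists_comp_eq_of_ker_le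
    (g := (f ∘ₗ C.subtype).coprod (g ∘ₗ D.subtype)) (h := C.subtype.coprod D.subtype) <| by
      rintro ⟨x, y⟩ hxy
      have hx : (x : V) = -(y : V) := eq_neg_of_add_eq_zero_left hxy
      simpa [h x x.2 (hx ▸ D.neg_mem y.2)] using by rw [hx]; simp
  exact ⟨l, fun x hx => by simpa using LinearMap.congr_fun hl (⟨x, hx⟩, 0),
    fun x hx => by simpa using LinearMap.congr_fun hl (0, ⟨x, hx⟩)⟩

theorem forall_mem_sup_span_singleton {D : Submodule F V} {x : V} {P : V → Prop}
    (h : ∀ d ∈ D, ∀ c : F, P (d + c • x)) : ∀ v ∈ D ⊔ F ∙ x, P v := by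
  intro v hv
  obtain ⟨d, hd, _, hc, rfl⟩ := Submodule.mem_sup.1 hv
  obtain ⟨c, rfl⟩ := Submodule.mem_span_singleton.1 hc
  exact h d hd c

theorem eq_zero_of_add_smul_mem {D : Submodule F V} {d x : V} {c : F} (hx : x ∉ D) (hd : d ∈ D)
    (h : d + c • x ∈ D) : c = 0 := by
  by_contra hc
  exact hx ((D.smul_mem_iff hc).1 ((D.add_mem_iff_right hd).1 h))

namespace IsPartialIsometry

variable {Q : U →ₗ[F] U →ₗ[F] F} {B : V →ₗ[F] V →ₗ[F] F} {S : Submodule F (U × V)}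

theorem swap (hS : IsPartialIsometry Q B S) :
    IsPartialIsometry B Q (S.comap (LinearEquiv.prodComm F V U).toLinearMap) where
  fg := by
    rw [Submodule.comap_equiv_eq_map_symm]
    exact hS.fg.map _
  isometry s hs t ht := (hS.isometry _ hs _ ht).symm
  snd_eq_zero s hs := hS.fst_eq_zero _ hs
  fst_eq_zero s hs := hS.snd_eq_zero _ hs

theorem exists_partner (hS : IsPartialIsometry Q B S) (hB : ExtensionProperty B) (x : U) :
    ∃ y, y ∉ S.map (LinearMap.snd F U V) ∧ (∀ s ∈ S, B y s.2 = Q x s.1) ∧ B y y = Q x x := by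
  obtain ⟨l, hl⟩ := exists_comp_eq_of_ker_le
    (g := Q x ∘ₗ LinearMap.fst F U V ∘ₗ S.subtype) (h := LinearMap.snd F U V ∘ₗ S.subtype)
    fun s hs => by
      have : s.1.1 = 0 := hS.fst_eq_zero s s.2 hs
      simp [this]
  obtain ⟨y, hyS, hyl, hyy⟩ := hB _ (hS.fg.map (LinearMap.snd F U V)) l (Q x x)
  exact ⟨y, hyS, fun s hs => (hyl _ (Submodule.mem_map_of_mem hs)).trans
    (LinearMap.congr_fun hl ⟨s, hs⟩), hyy⟩

theorem sup_span_singleton (hS : IsPartialIsometry Q B S) (hQ : ∀ u v, Q u v = Q v u)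
    (hB : ∀ u v, B u v = B v u) {x : U} {y : V} (hx : x ∉ S.map (LinearMap.fst F U V))
    (hy : y ∉ S.map (LinearMap.snd F U V)) (hxy : ∀ s ∈ S, B y s.2 = Q x s.1)
    (hyy : B y y = Q x x) : IsPartialIsometry Q B (S ⊔ F ∙ (x, y)) := by
  refine ⟨hS.fg.sup (Submodule.fg_span_singleton _),
    forall_mem_sup_span_singleton fun s hs c => forall_mem_sup_span_singleton fun t ht d => ?_,
    forall_mem_sup_span_singleton fun s hs c h => ?_,
    forall_mem_sup_span_singleton fun s hs c h => ?_⟩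
  · simp only [Prod.fst_add, Prod.snd_add, Prod.smul_fst, Prod.smul_snd, map_add, map_smul,
      LinearMap.add_apply, LinearMap.smul_apply, hQ s.1 x, hB s.2 y, hS.isometry s hs t ht,
      hxy s hs, hxy t ht, hyy]
  · obtain rfl := eq_zero_of_add_smul_mem hx (Submodule.mem_map_of_mem hs)
      (Submodule.mem_map.2 ⟨0, S.zero_mem, h.symm⟩)
    simpa using hS.snd_eq_zero s hs (by simpa using h)
  · obtain rfl := eq_zero_of_add_smul_mem hy (Submodule.mem_map_of_mem hs)
      (Submodule.mem_map.2 ⟨0, S.zero_mem, h.symm⟩)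
    simpa using hS.fst_eq_zero s hs (by simpa using h)

theorem exists_extend (hS : IsPartialIsometry Q B S) (hext : ExtensionProperty B)
    (hQ : ∀ u v, Q u v = Q v u) (hB : ∀ u v, B u v = B v u) (x : U) :
    ∃ S', S ≤ S' ∧ IsPartialIsometry Q B S' ∧ ∃ y, (x, y) ∈ S' := by
  by_cases hx : x ∈ S.map (LinearMap.fst F U V)
  · obtain ⟨⟨x, y⟩, hs, rfl⟩ := hx
    exact ⟨S, le_rfl, hS, y, hs⟩
  · obtain ⟨y, hy, hxy, hyy⟩ := hS.exists_partner hext x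
    exact ⟨S ⊔ F ∙ (x, y), le_sup_left, hS.sup_span_singleton hQ hB hx hy hxy hyy, y,
      Submodule.mem_sup_right (Submodule.mem_span_singleton_self _)⟩

end IsPartialIsometry

namespace SameTypeOver

variable {B : V →ₗ[F] V →ₗ[F] F} {A : Submodule F V} {x y z : E →ₗ[F] V}

theorem trans (h : SameTypeOver B A x y) (h' : SameTypeOver B A y z) : SameTypeOver B A x z :=
  ⟨fun e e' => (h.gram e e').trans (h'.gram e e'),
    fun e c hc => (h.inner e c hc).trans (h'.inner e c hc),
    fun e c hc => (h.relation e c hc).trans (h'.relation e c hc)⟩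

theorem exists_isPartialIsometry [FiniteDimensional F E] (h : SameTypeOver B A x y) (hA : A.FG)
    (hB : ∀ u v, B u v = B v u) :
    ∃ S, IsPartialIsometry B B S ∧ ∀ e, ∀ c ∈ A, (x e + c, y e + c) ∈ S := by
  have : FiniteDimensional F A := Module.Finite.iff_fg.2 hA
  refine ⟨LinearMap.range ((x.coprod A.subtype).prod (y.coprod A.subtype)),
    ⟨Module.Finite.iff_fg.1 inferInstance, ?_, ?_, ?_⟩, fun e c hc => ⟨(e, ⟨c, hc⟩), rfl⟩⟩
  · rintro _ ⟨⟨e, c⟩, rfl⟩ _ ⟨⟨e', c'⟩, rfl⟩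
    simp [h.gram, h.inner _ _ c'.2, hB c, h.inner _ _ c.2]
  · rintro _ ⟨⟨e, c⟩, rfl⟩ hx
    have := (h.relation e _ (A.neg_mem c.2)).1 (eq_neg_of_add_eq_zero_left hx)
    simp [this]
  · rintro _ ⟨⟨e, c⟩, rfl⟩ hy
    have := (h.relation e _ (A.neg_mem c.2)).2 (eq_neg_of_add_eq_zero_left hy)
    simp [this]

end SameTypeOver

/-- On the subspace `R` the tuple `z` is a copy of `u` over `A`, independent of `D` over `A`, whose
products with `D` are given by `l`. -/
structure IsGenericCopyOn (B : V →ₗ[F] V →ₗ[F] F) (A D : Submodule F V) (l : V →ₗ[F] E →ₗ[F] F)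
    (u z : E →ₗ[F] V) (R : Submodule F E) : Prop where
  comap_le : A.comap u ≤ R
  eq_of_mem : ∀ e, u e ∈ A → z e = u e
  mem_of_mem : ∀ e ∈ R, z e ∈ D → u e ∈ A
  inner : ∀ e ∈ R, ∀ d ∈ D, B (z e) d = l d e
  gram : ∀ e ∈ R, ∀ e' ∈ R, B (z e) (z e') = B (u e) (u e')

namespace IsGenericCopyOn

variable {B : V →ₗ[F] V →ₗ[F] F} {A D : Submodule F V} {l : V →ₗ[F] E →ₗ[F] F} {u z : E →ₗ[F] V}
  {R : Submodule F E}

theorem exists_image [FiniteDimensional F E] (hz : IsGenericCopyOn B A D l u z R)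
    (hext : ExtensionProperty B) (hD : D.FG) (hlA : ∀ d ∈ A, ∀ e, l d e = B (u e) d) (x : E) :
    ∃ y, y ∉ D ⊔ R.map z ∧ (∀ d ∈ D, B y d = l d x) ∧ (∀ e ∈ R, B y (z e) = B (u x) (u e)) ∧
      B y y = B (u x) (u x) := by
  obtain ⟨m, hm⟩ := exists_comp_eq_of_ker_le
    (g := (l.flip x ∘ₗ D.subtype).coprod (B (u x) ∘ₗ u ∘ₗ R.subtype))
    (h := D.subtype.coprod (z ∘ₗ R.subtype)) <| by
      rintro ⟨d, e⟩ hde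
      have hd : (d : V) = -z e := eq_neg_of_add_eq_zero_left hde
      have he : u e ∈ A := hz.mem_of_mem e e.2 (by simpa [hd] using D.neg_mem d.2)
      rw [hz.eq_of_mem e he] at hd
      simp [hd, hlA _ he]
  obtain ⟨y, hy, hym, hyy⟩ := hext (D ⊔ R.map z)
    (hD.sup ((IsNoetherian.noetherian R).map z)) m (B (u x) (u x))
  refine ⟨y, hy, fun d hd => (hym d (Submodule.mem_sup_left hd)).trans ?_, fun e he =>
    (hym _ (Submodule.mem_sup_right (Submodule.mem_map_of_mem he))).trans ?_, hyy⟩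
  · simpa using LinearMap.congr_fun hm (⟨d, hd⟩, 0)
  · simpa using LinearMap.congr_fun hm (0, ⟨e, he⟩)

theorem sup_span_singleton (hz : IsGenericCopyOn B A D l u z R) (hB : ∀ u v, B u v = B v u)
    {x : E} {z' : E →ₗ[F] V} (hz' : ∀ e ∈ R, z' e = z e) (hxD : z' x ∉ D ⊔ R.map z)
    (hinner : ∀ d ∈ D, B (z' x) d = l d x) (hgram : ∀ e ∈ R, B (z' x) (z e) = B (u x) (u e))
    (hself : B (z' x) (z' x) = B (u x) (u x)) : IsGenericCopyOn B A D l u z' (R ⊔ F ∙ x) := by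
  refine ⟨hz.comap_le.trans le_sup_left,
    fun e he => (hz' e (hz.comap_le he)).trans (hz.eq_of_mem e he),
    forall_mem_sup_span_singleton fun e he c h => ?_,
    forall_mem_sup_span_singleton fun e he c d hd => ?_,
    forall_mem_sup_span_singleton fun e he c => forall_mem_sup_span_singleton fun e' he' c' => ?_⟩
  · rw [map_add, map_smul, hz' e he] at h
    obtain rfl := eq_zero_of_add_smul_mem hxD
      (Submodule.mem_sup_right (Submodule.mem_map_of_mem he)) (Submodule.mem_sup_left h)
    simp only [zero_smul, add_zero] at h ⊢
    exact hz.mem_of_mem e he h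
  · simp [hz' e he, hz.inner e he d hd, hinner d hd]
  · simp [hz' e he, hz' e' he', hz.gram e he e' he', hgram e he, hgram e' he', hself,
      hB (z e) (z' x), hB (u e) (u x)]

theorem exists_extend [FiniteDimensional F E] (hz : IsGenericCopyOn B A D l u z R)
    (hext : ExtensionProperty B) (hB : ∀ u v, B u v = B v u) (hD : D.FG)
    (hlA : ∀ d ∈ A, ∀ e, l d e = B (u e) d) (x : E) :
    ∃ z' R', R ≤ R' ∧ x ∈ R' ∧ IsGenericCopyOn B A D l u z' R' := by
  by_cases hx : x ∈ R
  · exact ⟨z, R, le_rfl, hx, hz⟩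
  obtain ⟨y, hyD, hinner, hgram, hself⟩ := hz.exists_image hext hD hlA x
  obtain ⟨f, hfx, hfR⟩ := Submodule.exists_le_ker_of_notMem hx
  let z' : E →ₗ[F] V := z + f.smulRight ((f x)⁻¹ • (y - z x))
  have hz'x : z' x = y := by simp [z', smul_smul, hfx]
  have hz'R : ∀ e ∈ R, z' e = z e := fun e he => by simp [z', show f e = 0 from hfR he]
  rw [← hz'x] at hyD hself hgram hinner
  exact ⟨z', R ⊔ F ∙ x, le_sup_left,
    Submodule.mem_sup_right (Submodule.mem_span_singleton_self x),
    hz.sup_span_singleton hB hz'R hyD hinner hgram hself⟩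

end IsGenericCopyOn

theorem exists_isGenericCopyOn_top [FiniteDimensional F E] {B : V →ₗ[F] V →ₗ[F] F}
    (hext : ExtensionProperty B) (hB : ∀ u v, B u v = B v u) (u : E →ₗ[F] V)
    {A D : Submodule F V} (hD : D.FG) (l : V →ₗ[F] E →ₗ[F] F)
    (hl : ∀ d ∈ D, ∀ e, u e ∈ A → l d e = B (u e) d) (hlA : ∀ d ∈ A, ∀ e, l d e = B (u e) d) :
    ∃ z, IsGenericCopyOn B A D l u z ⊤ := by
  classical
  suffices h : ∀ s : Finset E, ∃ (z : E →ₗ[F] V) (R : Submodule F E),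
      ↑s ⊆ (R : Set E) ∧ IsGenericCopyOn B A D l u z R by
    obtain ⟨s, hs⟩ := (inferInstance : FiniteDimensional F E)
    obtain ⟨z, R, hsR, hz⟩ := h s
    obtain rfl : R = ⊤ := top_le_iff.1 (hs.ge.trans (Submodule.span_le.2 hsR))
    exact ⟨z, hz⟩
  intro s
  induction s using Finset.induction_on with
  | empty =>
    exact ⟨u, A.comap u, by simp, le_rfl, fun _ _ => rfl, fun _ he _ => he,
      fun e he d hd => (hl d hd e he).symm, fun _ _ _ _ => rfl⟩
  | insert x s _ ih =>
    obtain ⟨z, R, hsR, hz⟩ := ih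
    obtain ⟨z', R', hR, hx, hz'⟩ := hz.exists_extend hext hB hD hlA x
    refine ⟨z', R', ?_, hz'⟩
    rw [Finset.coe_insert]
    exact Set.insert_subset hx (hsR.trans hR)

theorem IsGenericCopyOn.sameTypeOver {B : V →ₗ[F] V →ₗ[F] F} {A D : Submodule F V}
    {l : V →ₗ[F] E →ₗ[F] F} {u z : E →ₗ[F] V} (hz : IsGenericCopyOn B A D l u z ⊤) (hAD : A ≤ D)
    (hlA : ∀ d ∈ A, ∀ e, l d e = B (u e) d) : SameTypeOver B A u z where
  gram e e' := (hz.gram e trivial e' trivial).symm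
  inner e c hc := by rw [hz.inner e trivial c (hAD hc), hlA c hc]
  relation e c hc := by
    constructor
    · rintro rfl
      exact hz.eq_of_mem e hc
    · rintro rfl
      exact (hz.eq_of_mem e (hz.mem_of_mem e trivial (hAD hc))).symm

end LinearAlgebra

section Finiteness

/-- The data that determine the type of the tuple `x` over `A`: its Gram form, its products with
`A`, and its linear combinations lying in `A`. -/
noncomputable def typeCode {F E V : Type*} [CommRing F] [AddCommGroup E] [Module F E]
    [AddCommGroup V] [Module F V] (B : V →ₗ[F] V →ₗ[F] F) (A : Submodule F V) (x : E →ₗ[F] V) :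
    (E →ₗ[F] E →ₗ[F] F) × (E →ₗ[F] A →ₗ[F] F) × (E → Option A) :=
  open Classical in (B.compl₁₂ x x, B.compl₁₂ x A.subtype,
    fun e => if h : x e ∈ A then some ⟨x e, h⟩ else none)

theorem sameTypeOver_of_typeCode_eq {F E V : Type*} [CommRing F] [AddCommGroup E] [Module F E]
    [AddCommGroup V] [Module F V] {B : V →ₗ[F] V →ₗ[F] F} {A : Submodule F V} {x y : E →ₗ[F] V}
    (h : typeCode B A x = typeCode B A y) : SameTypeOver B A x y := by
  simp only [typeCode, Prod.mk.injEq] at h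
  obtain ⟨hgram, hinner, hrelation⟩ := h
  refine ⟨LinearMap.congr_fun₂ hgram, fun e c hc => LinearMap.congr_fun₂ hinner e ⟨c, hc⟩,
    fun e c hc => ?_⟩
  have he := congrFun hrelation e
  constructor <;> rintro rfl
  · simp only [hc, dite_true] at he
    split_ifs at he
    simpa using he.symm
  · simp only [hc, dite_true] at he
    split_ifs at he
    simpa using he

theorem exists_infinite_subset_const {ι β : Type*} [Finite β] {I : Set ι} (hI : I.Infinite)
    (f : ι → β) : ∃ J ⊆ I, J.Infinite ∧ ∃ b, ∀ i ∈ J, f i = b := by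
  by_contra! h
  have hfin (b : β) : {i ∈ I | f i = b}.Finite := by
    by_contra hb
    obtain ⟨i, hi, hi'⟩ := h {i ∈ I | f i = b} (fun i hi => hi.1) hb b
    exact hi' hi.2
  exact hI ((Set.finite_iUnion hfin).subset fun i hi => Set.mem_iUnion.2 ⟨f i, hi, rfl⟩)

theorem exists_infinite_subset_const_maximal {ι α β : Type*} [Finite α] {I : Set ι}
    (hI : I.Infinite) (w : ι → α → β) :
    ∃ J ⊆ I, J.Infinite ∧ ∀ J' ⊆ J, J'.Infinite → ∀ e, (∀ i ∈ J', ∀ j ∈ J', w i e = w j e) →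
      ∀ i ∈ J, ∀ j ∈ J, w i e = w j e := by
  let const (J : Set ι) : Set α := {e | ∀ i ∈ J, ∀ j ∈ J, w i e = w j e}
  obtain ⟨_, ⟨J, hJI, hJ, rfl⟩, hmax⟩ := (wellFounded_gt (α := Set α)).has_min
    {C | ∃ J ⊆ I, J.Infinite ∧ const J = C} ⟨_, I, subset_rfl, hI, rfl⟩
  refine ⟨J, hJI, hJ, fun J' hJ' hinf e he => ?_⟩
  have hsub : const J ⊆ const J' := fun e he i hi j hj => he i (hJ' hi) j (hJ' hj)
  by_contra heJ
  exact hmax (const J') ⟨J', hJ'.trans hJI, hinf, rfl⟩ (hsub.ssubset_of_mem_notMem he heJ)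

variable {F E E' V W : Type*} [Field F] [AddCommGroup E] [Module F E] [AddCommGroup E']
  [Module F E'] [AddCommGroup V] [Module F V] [AddCommGroup W] [Module F W] {ι : Type*}

theorem finite_of_fg [Finite F] {D : Submodule F V} (hD : D.FG) : Finite D :=
  have : Module.Finite F D := Module.Finite.iff_fg.2 hD
  Module.finite_of_finite F

theorem exists_infinite_sameTypeOver [Finite F] [FiniteDimensional F E] (B : V →ₗ[F] V →ₗ[F] F)
    {A : Submodule F V} (hA : A.FG) {I : Set ι} (hI : I.Infinite) (x : ι → E →ₗ[F] V) :
    ∃ J ⊆ I, J.Infinite ∧ ∀ i ∈ J, ∀ j ∈ J, SameTypeOver B A (x i) (x j) := by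
  have : Module.Finite F A := Module.Finite.iff_fg.2 hA
  have : Finite A := Module.finite_of_finite F
  have : Finite E := Module.finite_of_finite F
  have : Finite (E →ₗ[F] E →ₗ[F] F) := Module.finite_of_finite F
  have : Finite (E →ₗ[F] A →ₗ[F] F) := Module.finite_of_finite F
  obtain ⟨J, hJI, hJ, b, hb⟩ := exists_infinite_subset_const hI fun i => typeCode B A (x i)
  exact ⟨J, hJI, hJ, fun i hi j hj => sameTypeOver_of_typeCode_eq ((hb i hi).trans (hb j hj).symm)⟩

/-- The ranges of the `w i`, `i ∈ J`, form a sunflower with kernel `A`: each finitely generated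
submodule meets almost all of them inside `A`. -/
def IsSunflower (J : Set ι) (w : ι → E →ₗ[F] V) (A : Submodule F V) : Prop :=
  ∀ D : Submodule F V, D.FG → {i ∈ J | ¬ LinearMap.range (w i) ⊓ D ≤ A}.Finite

theorem IsSunflower.mono {J J' : Set ι} {w : ι → E →ₗ[F] V} {A A' : Submodule F V}
    (h : IsSunflower J w A) (hJ : J' ⊆ J) (hA : A ≤ A') : IsSunflower J' w A' :=
  fun D hD => (h D hD).subset fun _ hi => ⟨hJ hi.1, fun hle => hi.2 (hle.trans hA)⟩

theorem exists_isSunflower [Finite F] [FiniteDimensional F E] {I : Set ι} (hI : I.Infinite)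
    (w : ι → E →ₗ[F] V) :
    ∃ J ⊆ I, J.Infinite ∧ ∃ A : Submodule F V, A.FG ∧ IsSunflower J w A := by
  have : Finite E := Module.finite_of_finite F
  obtain ⟨J, hJI, hJ, hmax⟩ := exists_infinite_subset_const_maximal hI fun i e => w i e
  obtain ⟨j, hj⟩ := hJ.nonempty
  refine ⟨J, hJI, hJ, LinearMap.range (w j), Module.Finite.iff_fg.1 inferInstance, fun D hD => ?_⟩
  by_contra hinf
  have := finite_of_fg hD
  have hbad : ∀ i ∈ {i ∈ J | ¬ LinearMap.range (w i) ⊓ D ≤ LinearMap.range (w j)},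
      ∃ ed : E × D, w i ed.1 = ed.2 ∧ (ed.2 : V) ∉ LinearMap.range (w j) := by
    rintro i ⟨-, hi⟩
    obtain ⟨_, ⟨⟨e, rfl⟩, hD⟩, hj⟩ := SetLike.not_le_iff_exists.1 hi
    exact ⟨(e, ⟨_, hD⟩), rfl, hj⟩
  choose! f hf using hbad
  obtain ⟨J', hJ'J, hJ', ⟨e, d⟩, hed⟩ := exists_infinite_subset_const hinf f
  have hwd : ∀ i ∈ J', w i e = d := fun i hi => by simpa [hed i hi] using (hf i (hJ'J hi)).1
  have hconst := hmax J' (fun i hi => (hJ'J hi).1) hJ' e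
    fun i hi i' hi' => (hwd i hi).trans (hwd i' hi').symm
  obtain ⟨i, hi⟩ := hJ'.nonempty
  refine (hf i (hJ'J hi)).2 ⟨e, ?_⟩
  rw [hed i hi, ← hwd i hi, hconst j hj i (hJ'J hi).1]

theorem IsSunflower.exists_glue [FiniteDimensional F E] {J : Set ι} (hJ : J.Infinite)
    {w : ι → E →ₗ[F] V} {A : Submodule F V} (hw : IsSunflower J w A) (hA : A.FG) (f : ι → V →ₗ[F] W)
    (hf : ∀ i ∈ J, ∀ j ∈ J, ∀ x ∈ A, f i x = f j x) (k : ℕ) :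
    ∃ s : Finset ι, s.card = k ∧ ↑s ⊆ J ∧ ∃ l : V →ₗ[F] W, (∀ i ∈ J, ∀ x ∈ A, l x = f i x) ∧
      ∀ i ∈ s, ∀ x ∈ LinearMap.range (w i), l x = f i x := by
  classical
  induction k with
  | zero =>
    obtain ⟨j, hj⟩ := hJ.nonempty
    exact ⟨∅, rfl, by simp, f j, fun i hi x hx => hf j hj i hi x hx, by simp⟩
  | succ k ih =>
    obtain ⟨s, hs, hsJ, l, hlA, hl⟩ := ih
    let D : Submodule F V := A ⊔ ⨆ i ∈ s, LinearMap.range (w i)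
    have hD : D.FG := hA.sup (Submodule.fg_biSup s _ fun i _ =>
      Module.Finite.iff_fg.1 inferInstance)
    obtain ⟨i, hiJ, hi⟩ := (hJ.sdiff ((hw D hD).union s.finite_toSet)).nonempty
    have hiD : LinearMap.range (w i) ⊓ D ≤ A := by
      by_contra h
      exact hi (Or.inl ⟨hiJ, h⟩)
    have his : i ∉ s := fun h => hi (Or.inr h)
    obtain ⟨l', hl'D, hl'i⟩ := BilinearSpace.exists_glue l (f i) D (LinearMap.range (w i))
      fun x hxD hxi => hlA i hiJ x (hiD ⟨hxi, hxD⟩)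
    refine ⟨insert i s, by rw [Finset.card_insert_of_notMem his, hs], ?_, l', ?_, ?_⟩
    · rw [Finset.coe_insert]
      exact Set.insert_subset hiJ hsJ
    · exact fun j hj x hx => (hl'D x (Submodule.mem_sup_left hx)).trans (hlA j hj x hx)
    · refine fun j hj x hx => (Finset.mem_insert.1 hj).elim (fun h => ?_) fun hj => ?_
      · subst h
        exact hl'i x hx
      · exact (hl'D x (Submodule.mem_sup_right
          (Submodule.mem_iSup_of_mem j (Submodule.mem_iSup_of_mem hj hx)))).trans (hl j hj x hx)

theorem exists_common_copy_of_inner [FiniteDimensional F E] [FiniteDimensional F E']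
    {B : V →ₗ[F] V →ₗ[F] F} (hext : ExtensionProperty B) (hB : ∀ u v, B u v = B v u)
    {A : Submodule F V} (hA : A.FG) {s : Finset ι} {u : E →ₗ[F] V} {x : ι → E →ₗ[F] V}
    {a : ι → E' →ₗ[F] V} {l : V →ₗ[F] E →ₗ[F] F} (hx : ∀ i ∈ s, SameTypeOver B A (x i) u)
    (hlA : ∀ c ∈ A, ∀ e, l c e = B (u e) c)
    (hl : ∀ i ∈ s, ∀ c ∈ LinearMap.range (a i), ∀ e, l c e = B (x i e) c)
    (hrel : ∀ i ∈ s, ∀ e, x i e ∈ LinearMap.range (a i) → x i e ∈ A) :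
    ∃ z, ∀ i ∈ s, SameTypeOver B (LinearMap.range (a i)) (x i) z := by
  let D : Submodule F V := A ⊔ ⨆ i ∈ s, LinearMap.range (a i)
  have hD : D.FG := hA.sup (Submodule.fg_biSup s _ fun i _ =>
    Module.Finite.iff_fg.1 inferInstance)
  have haD : ∀ i ∈ s, LinearMap.range (a i) ≤ D := fun i hi =>
    (le_biSup (fun i => LinearMap.range (a i)) hi).trans le_sup_right
  have hlD : ∀ d ∈ D, ∀ e, u e ∈ A → l d e = B (u e) d := by
    intro d hd e he
    have hle : D ≤ LinearMap.ker (l.flip e - B (u e)) := by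
      refine sup_le (fun c hc => ?_) (iSup₂_le fun i hi c hc => ?_)
      · simp [hlA c hc]
      · simp [hl i hi c hc, ((hx i hi).relation e _ he).2 rfl]
    simpa [sub_eq_zero] using hle hd
  obtain ⟨z, hz⟩ := exists_isGenericCopyOn_top hext hB u hD l hlD hlA
  refine ⟨z, fun i hi => ?_⟩
  have hiz := (hx i hi).trans (hz.sameTypeOver le_sup_left hlA)
  refine ⟨hiz.gram, fun e c hc => ?_, fun e c hc => ⟨?_, ?_⟩⟩
  · rw [hz.inner e trivial c (haD i hi hc), hl i hi c hc]
  · rintro rfl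
    exact (hiz.relation e _ (hrel i hi e hc)).1 rfl
  · rintro rfl
    have he := hz.mem_of_mem e trivial (haD i hi hc)
    exact (hiz.relation e _ (by rwa [hz.eq_of_mem e he])).2 rfl

theorem exists_common_copy [Finite F] [FiniteDimensional F E] [FiniteDimensional F E']
    {B : V →ₗ[F] V →ₗ[F] F} (hext : ExtensionProperty B) (hB : ∀ u v, B u v = B v u)
    {A : Submodule F V} (hA : A.FG) {I : Set ι} (hI : I.Infinite) (x : ι → E →ₗ[F] V)
    (a : ι → E' →ₗ[F] V) (hrel : ∀ i ∈ I, ∀ e, x i e ∈ LinearMap.range (a i) → x i e ∈ A) (k : ℕ) :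
    ∃ s : Finset ι, s.card = k ∧ ↑s ⊆ I ∧
      ∃ z, ∀ i ∈ s, SameTypeOver B (LinearMap.range (a i)) (x i) z := by
  obtain ⟨J₁, hJ₁I, hJ₁, A₁, hA₁, hflower⟩ := exists_isSunflower hI a
  have hC : (A ⊔ A₁).FG := hA.sup hA₁
  obtain ⟨J, hJJ₁, hJ, htype⟩ := exists_infinite_sameTypeOver B hC hJ₁ x
  obtain ⟨s, hs, hsJ, l, hlC, hl⟩ := (hflower.mono hJJ₁ le_sup_right).exists_glue hJ hC
    (fun i => (B.compl₁₂ (x i) LinearMap.id).flip)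
    (fun i hi j hj c hc => LinearMap.ext fun e => (htype i hi j hj).inner e c hc) k
  obtain ⟨j, hj⟩ := hJ.nonempty
  have hsI : ↑s ⊆ I := hsJ.trans (hJJ₁.trans hJ₁I)
  exact ⟨s, hs, hsI, exists_common_copy_of_inner hext hB hC (fun i hi => htype i (hsJ hi) j hj)
    (fun c hc => LinearMap.congr_fun (hlC j hj c hc))
    (fun i hi c hc => LinearMap.congr_fun (hl i hi c hc))
    fun i hi e he => Submodule.mem_sup_left (hrel i (hsI hi) e he)⟩

end Finiteness

section Presentation

open FirstOrder.Language

/-- `k` belongs to the scalar sort. -/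
def IsScal {K : Type} [lang.Structure K] (k : K) : Prop :=
  Structure.RelMap (L := lang) Rel.scal ![k]

/-- `k · l = m`. -/
def IsDot {K : Type} [lang.Structure K] (k l m : K) : Prop :=
  Structure.RelMap (L := lang) Rel.dot ![k, l, m]

/-- A presentation of the structure `K` as the disjoint union of the vector space `V` and the
prime field, with the symmetric bilinear form `B`. -/
structure Presentation (p : ℕ) (V : Type*) [AddCommGroup V] [Module (ZMod p) V]
    (B : V →ₗ[ZMod p] V →ₗ[ZMod p] ZMod p) (K : Type) [lang.Structure K] where
  equiv : V ⊕ ZMod p ≃ K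
  zeroVec_eq : zeroVec K = equiv (.inl 0)
  isVec_iff : ∀ k, IsVec k ↔ ∃ x, k = equiv (.inl x)
  isScal_iff : ∀ k, IsScal k ↔ ∃ c, k = equiv (.inr c)
  isAdd_iff : ∀ k l m, IsAdd k l m ↔
    ∃ x y, k = equiv (.inl x) ∧ l = equiv (.inl y) ∧ m = equiv (.inl (x + y))
  isDot_iff : ∀ k l m, IsDot k l m ↔
    ∃ x y, k = equiv (.inl x) ∧ l = equiv (.inl y) ∧ m = equiv (.inr (B x y))
  symm : ∀ x y, B x y = B y x

section

variable {K : Type} [lang.Structure K]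

theorem relMap_vec_iff (t : Fin 1 → K) :
    Structure.RelMap (L := lang) Rel.vec t ↔ IsVec (t 0) :=
  iff_of_eq (congrArg _ (by ext i; fin_cases i; rfl))

theorem relMap_scal_iff (t : Fin 1 → K) :
    Structure.RelMap (L := lang) Rel.scal t ↔ IsScal (t 0) :=
  iff_of_eq (congrArg _ (by ext i; fin_cases i; rfl))

theorem relMap_add_iff (t : Fin 3 → K) :
    Structure.RelMap (L := lang) Rel.add t ↔ IsAdd (t 0) (t 1) (t 2) :=
  iff_of_eq (congrArg _ (by ext i; fin_cases i <;> rfl))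

theorem relMap_dot_iff (t : Fin 3 → K) :
    Structure.RelMap (L := lang) Rel.dot t ↔ IsDot (t 0) (t 1) (t 2) :=
  iff_of_eq (congrArg _ (by ext i; fin_cases i <;> rfl))

theorem funMap_zero (t : Fin 0 → K) : Structure.funMap (L := lang) Func.zero t = zeroVec K :=
  congrArg (Structure.funMap (L := lang) Func.zero) (Subsingleton.elim _ _)

end

namespace Presentation

variable {p : ℕ} {V : Type*} [AddCommGroup V] [Module (ZMod p) V]
  {B : V →ₗ[ZMod p] V →ₗ[ZMod p] ZMod p} {K : Type} [lang.Structure K]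
  {W : Type*} [AddCommGroup W] [Module (ZMod p) W]
  {C : W →ₗ[ZMod p] W →ₗ[ZMod p] ZMod p} {K' : Type} [lang.Structure K']

/-- The element of `K` that is the vector `x`. -/
def vec (P : Presentation p V B K) (x : V) : K := P.equiv (.inl x)

/-- The vector `x` if `k` is the vector `x`, and `0` if `k` is a scalar. -/
def vecPart (P : Presentation p V B K) (k : K) : V := Sum.elim id 0 (P.equiv.symm k)

/-- The scalar `c` if `k` is the scalar `c`, and `none` if `k` is a vector. -/
def scalPart (P : Presentation p V B K) (k : K) : Option (ZMod p) :=
  Sum.elim (fun _ => none) some (P.equiv.symm k)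

section Parts

variable (P : Presentation p V B K)

theorem vec_injective : Function.Injective P.vec := P.equiv.injective.comp Sum.inl_injective

@[simp] theorem vecPart_vec (x : V) : P.vecPart (P.vec x) = x := by simp [vecPart, vec]

@[simp] theorem scalPart_vec (x : V) : P.scalPart (P.vec x) = none := by simp [scalPart, vec]

theorem ext_parts {k l : K} (hs : P.scalPart k = P.scalPart l) (hv : P.vecPart k = P.vecPart l) :
    k = l := by
  obtain ⟨x | c, rfl⟩ := P.equiv.surjective k <;> obtain ⟨y | d, rfl⟩ := P.equiv.surjective l <;>
    simp_all [scalPart, vecPart]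

theorem exists_parts (k : K) (v : V) (hv : P.vecPart k = 0 → v = 0) :
    ∃ k', P.scalPart k' = P.scalPart k ∧ P.vecPart k' = v := by
  obtain ⟨x | c, rfl⟩ := P.equiv.surjective k
  · exact ⟨P.vec v, by simp [scalPart, vec], by simp⟩
  · exact ⟨P.equiv (.inr c), rfl, by rw [hv] <;> simp [vecPart]⟩

theorem isVec_vec (x : V) : IsVec (P.vec x) := (P.isVec_iff _).2 ⟨x, rfl⟩

theorem isAdd_vec_iff {x y : V} {k : K} : IsAdd (P.vec x) (P.vec y) k ↔ k = P.vec (x + y) := by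
  simp [P.isAdd_iff, vec]

theorem isVec_iff_parts {k : K} : IsVec k ↔ P.scalPart k = none := by
  obtain ⟨x | c, rfl⟩ := P.equiv.surjective k <;> simp [P.isVec_iff, scalPart]

theorem isScal_iff_parts {k : K} : IsScal k ↔ P.scalPart k ≠ none := by
  obtain ⟨x | c, rfl⟩ := P.equiv.surjective k <;> simp [P.isScal_iff, scalPart]

theorem isAdd_iff_parts {k l m : K} : IsAdd k l m ↔ P.scalPart k = none ∧ P.scalPart l = none ∧
    P.scalPart m = none ∧ P.vecPart k + P.vecPart l - P.vecPart m = 0 := by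
  obtain ⟨x | c, rfl⟩ := P.equiv.surjective k <;> obtain ⟨y | d, rfl⟩ := P.equiv.surjective l <;>
    obtain ⟨z | e, rfl⟩ := P.equiv.surjective m <;>
    simp [P.isAdd_iff, scalPart, vecPart, sub_eq_zero, eq_comm]

theorem isDot_iff_parts {k l m : K} : IsDot k l m ↔ P.scalPart k = none ∧ P.scalPart l = none ∧
    P.scalPart m = some (B (P.vecPart k) (P.vecPart l)) := by
  obtain ⟨x | c, rfl⟩ := P.equiv.surjective k <;> obtain ⟨y | d, rfl⟩ := P.equiv.surjective l <;>
    obtain ⟨z | e, rfl⟩ := P.equiv.surjective m <;> simp [P.isDot_iff, scalPart, vecPart]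

end Parts

/-- The relation between elements induced by a relation between vectors. -/
def Related (P : Presentation p V B K) (P' : Presentation p W C K')
    (S : Submodule (ZMod p) (V × W)) (k : K) (k' : K') : Prop :=
  P.scalPart k = P'.scalPart k' ∧ (P.vecPart k, P'.vecPart k') ∈ S

namespace Related

variable {P : Presentation p V B K} {P' : Presentation p W C K'}
  {S S' : Submodule (ZMod p) (V × W)}

theorem mono (h : S ≤ S') {k : K} {k' : K'} (hk : Related P P' S k k') : Related P P' S' k k' :=
  ⟨hk.1, h hk.2⟩

theorem swap {k : K} {k' : K'} (hk : Related P P' S k k') :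
    Related P' P (S.comap (LinearEquiv.prodComm (ZMod p) W V).toLinearMap) k' k :=
  ⟨hk.1.symm, hk.2⟩

theorem eq_of_eq (hS : IsPartialIsometry B C S) {k l : K} {k' l' : K'}
    (hk : Related P P' S k k') (hl : Related P P' S l l') (h : k = l) : k' = l' := by
  subst h
  refine P'.ext_parts (hk.1.symm.trans hl.1) (sub_eq_zero.1 ?_)
  exact hS.snd_eq_zero _ (S.sub_mem hk.2 hl.2) (sub_self _)

theorem relMap (hS : IsPartialIsometry B C S) {n : ℕ} (r : lang.Relations n)
    {t : Fin n → K} {t' : Fin n → K'} (h : ∀ i, Related P P' S (t i) (t' i))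
    (ht : Structure.RelMap r t) : Structure.RelMap r t' := by
  have hs : ∀ i, P.scalPart (t i) = P'.scalPart (t' i) := fun i => (h i).1
  rcases r with _ | _ | _ | _
  · rwa [relMap_vec_iff, P'.isVec_iff_parts, ← hs, ← P.isVec_iff_parts, ← relMap_vec_iff]
  · rwa [relMap_scal_iff, P'.isScal_iff_parts, ← hs, ← P.isScal_iff_parts, ← relMap_scal_iff]
  · rw [relMap_add_iff, P.isAdd_iff_parts] at ht
    rw [relMap_add_iff, P'.isAdd_iff_parts]
    rw [hs, hs, hs] at ht
    exact ⟨ht.1, ht.2.1, ht.2.2.1, hS.snd_eq_zero _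
      (S.sub_mem (S.add_mem (h 0).2 (h 1).2) (h 2).2) ht.2.2.2⟩
  · rw [relMap_dot_iff, P.isDot_iff_parts] at ht
    rw [relMap_dot_iff, P'.isDot_iff_parts]
    rwa [hs, hs, hs, hS.isometry _ (h 0).2 _ (h 1).2] at ht

theorem realize_term {α : Type*} (t : lang.Term α) {v : α → K} {v' : α → K'}
    (h : ∀ i, Related P P' S (v i) (v' i)) : Related P P' S (t.realize v) (t.realize v') := by
  induction t with
  | var i => exact h i
  | func f ts _ =>
    cases f
    change Related P P' S (Structure.funMap (L := lang) Func.zero _)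
      (Structure.funMap (L := lang) Func.zero _)
    rw [funMap_zero, funMap_zero, P.zeroVec_eq, P'.zeroVec_eq]
    exact ⟨by simp [scalPart], by simp only [vecPart, Equiv.symm_apply_apply]; exact S.zero_mem⟩

theorem snoc {n : ℕ} {xs : Fin n → K} {xs' : Fin n → K'} {k : K} {k' : K'}
    (hxs : ∀ i, Related P P' S (xs i) (xs' i)) (hk : Related P P' S k k') (i : Fin (n + 1)) :
    Related P P' S (Fin.snoc (α := fun _ => K) xs k i) (Fin.snoc (α := fun _ => K') xs' k' i) := by
  refine Fin.lastCases ?_ (fun i => ?_) i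
  · simpa using hk
  · simpa using hxs i

end Related

theorem exists_related [Fact p.Prime] (P : Presentation p V B K) (P' : Presentation p W C K')
    (hC : ExtensionProperty C) {S : Submodule (ZMod p) (V × W)} (hS : IsPartialIsometry B C S)
    (k : K) : ∃ S', S ≤ S' ∧ IsPartialIsometry B C S' ∧ ∃ k', Related P P' S' k k' := by
  obtain ⟨S', hSS', hS', y, hy⟩ := hS.exists_extend hC P.symm P'.symm (P.vecPart k)
  obtain ⟨x | c, rfl⟩ := P.equiv.surjective k
  · exact ⟨S', hSS', hS', P'.vec y, by simp [scalPart, vec], by simpa using hy⟩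
  · refine ⟨S, le_rfl, hS, P'.equiv (.inr c), by simp [scalPart], ?_⟩
    simp only [vecPart, Equiv.symm_apply_apply]
    exact S.zero_mem

theorem realize_boundedFormula_iff [Fact p.Prime] {P : Presentation p V B K}
    {P' : Presentation p W C K'} (hB : ExtensionProperty B) (hC : ExtensionProperty C) {α : Type*}
    {n : ℕ} (φ : lang.BoundedFormula α n) {v : α → K} {xs : Fin n → K} {v' : α → K'}
    {xs' : Fin n → K'} {S : Submodule (ZMod p) (V × W)} (hS : IsPartialIsometry B C S)
    (hv : ∀ i, Related P P' S (v i) (v' i)) (hxs : ∀ i, Related P P' S (xs i) (xs' i)) :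
    φ.Realize v xs ↔ φ.Realize v' xs' := by
  have hterm {n : ℕ} {xs : Fin n → K} {xs' : Fin n → K'} {S : Submodule (ZMod p) (V × W)}
      (hv : ∀ i, Related P P' S (v i) (v' i)) (hxs : ∀ i, Related P P' S (xs i) (xs' i))
      (t : lang.Term (α ⊕ Fin n)) :
      Related P P' S (t.realize (Sum.elim v xs)) (t.realize (Sum.elim v' xs')) :=
    Related.realize_term t (Sum.rec hv hxs)
  induction φ generalizing S with
  | falsum => rfl
  | equal t₁ t₂ =>
    have h₁ := hterm hv hxs t₁
    have h₂ := hterm hv hxs t₂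
    exact ⟨h₁.eq_of_eq hS h₂, h₁.swap.eq_of_eq hS.swap h₂.swap⟩
  | rel r ts =>
    have h := fun i => hterm hv hxs (ts i)
    exact ⟨Related.relMap hS r h, Related.relMap hS.swap r fun i => (h i).swap⟩
  | imp φ₁ φ₂ ih₁ ih₂ =>
    exact imp_congr (ih₁ hS hv hxs) (ih₂ hS hv hxs)
  | all φ ih =>
    rw [BoundedFormula.realize_all, BoundedFormula.realize_all]
    refine ⟨fun h k' => ?_, fun h k => ?_⟩
    · obtain ⟨S', hle, hS', k, hk⟩ := exists_related P' P hB hS.swap k'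
      have hle' : S ≤ S'.comap (LinearEquiv.prodComm (ZMod p) V W).toLinearMap :=
        fun s hs => @hle (s.2, s.1) hs
      exact (ih hS'.swap (fun i => (hv i).mono hle')
        (Related.snoc (fun i => (hxs i).mono hle') hk.swap)).1 (h k)
    · obtain ⟨S', hle, hS', k', hk⟩ := exists_related P P' hC hS k
      exact (ih hS' (fun i => (hv i).mono hle)
        (Related.snoc (fun i => (hxs i).mono hle) hk)).2 (h k')

theorem realize_formula_iff_of_sameTypeOver [Fact p.Prime] (P : Presentation p V B K)
    (hB : ExtensionProperty B) {E : Type*} [AddCommGroup E] [Module (ZMod p) E]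
    [FiniteDimensional (ZMod p) E] {A : Submodule (ZMod p) V} (hA : A.FG) {x x' : E →ₗ[ZMod p] V}
    (hx : SameTypeOver B A x x') {α : Type*} (φ : lang.Formula α) {v v' : α → K}
    (hs : ∀ i, P.scalPart (v i) = P.scalPart (v' i))
    (hv : ∀ i, ∃ e, ∃ c ∈ A, P.vecPart (v i) = x e + c ∧ P.vecPart (v' i) = x' e + c) :
    φ.Realize v ↔ φ.Realize v' := by
  obtain ⟨S, hS, hxS⟩ := hx.exists_isPartialIsometry hA P.symm
  refine realize_boundedFormula_iff hB hB φ hS (fun i => ⟨hs i, ?_⟩) finZeroElim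
  obtain ⟨e, c, hc, h, h'⟩ := hv i
  exact h ▸ h' ▸ hxS e c hc

/-- The linear map sending the coordinate vectors to the vector parts of the tuple `x`. -/
noncomputable def comb (P : Presentation p V B K) {α : Type*} [Fintype α] (x : α → K) :
    (α → ZMod p) →ₗ[ZMod p] V :=
  Fintype.linearCombination (ZMod p) fun i => P.vecPart (x i)

theorem comb_single (P : Presentation p V B K) {α : Type*} [Fintype α] [DecidableEq α] (x : α → K)
    (i : α) : P.comb x (Pi.single i 1) = P.vecPart (x i) := by
  simp [comb]

theorem vecPart_mem_range_comb (P : Presentation p V B K) {α : Type*} [Fintype α] (x : α → K)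
    (i : α) : P.vecPart (x i) ∈ LinearMap.range (P.comb x) := by
  classical
  exact ⟨Pi.single i 1, P.comb_single x i⟩

theorem realize_sumElim_iff_of_sameTypeOver [Fact p.Prime] (P : Presentation p V B K)
    (hB : ExtensionProperty B) {α β : Type*} [Fintype α] {A : Submodule (ZMod p) V} (hA : A.FG)
    (φ : lang.Formula (β ⊕ α)) {w : β → K} (hw : ∀ j, P.vecPart (w j) ∈ A) {x x' : α → K}
    (hs : ∀ i, P.scalPart (x i) = P.scalPart (x' i))
    (hx : SameTypeOver B A (P.comb x) (P.comb x')) :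
    φ.Realize (Sum.elim w x) ↔ φ.Realize (Sum.elim w x') := by
  classical
  refine P.realize_formula_iff_of_sameTypeOver hB hA hx φ (Sum.rec (fun _ => rfl) hs) ?_
  rintro (j | i)
  · exact ⟨0, _, hw j, by simp, by simp⟩
  · exact ⟨Pi.single i 1, 0, A.zero_mem, by simp [comb_single], by simp [comb_single]⟩

end Presentation

end Presentation

section StandardModel

section

variable {F V : Type*} [Field F] [AddCommGroup V] [Module F V] {B : V →ₗ[F] V →ₗ[F] F}

theorem exists_represents (hB : B.SeparatingRight) {D : Submodule F V} (hD : D.FG)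
    (l : V →ₗ[F] F) : ∃ x, ∀ d ∈ D, B x d = l d := by
  have : FiniteDimensional F D := Module.Finite.iff_fg.2 hD
  let restrict : V →ₗ[F] Module.Dual F D := Module.Dual.transpose D.subtype ∘ₗ B
  have hbot : (LinearMap.range restrict).dualCoannihilator = ⊥ := by
    refine (Submodule.eq_bot_iff _).2 fun d hd => ?_
    rw [Submodule.mem_dualCoannihilator] at hd
    exact Subtype.ext (hB d fun x => hd _ ⟨x, rfl⟩)
  have htop : LinearMap.range restrict = ⊤ := by
    rw [← Subspace.dualCoannihilator_dualAnnihilator_eq (W := LinearMap.range restrict), hbot,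
      Submodule.dualAnnihilator_bot]
  obtain ⟨x, hx⟩ := LinearMap.range_eq_top.1 htop (l ∘ₗ D.subtype)
  exact ⟨x, fun d hd => LinearMap.congr_fun hx ⟨d, hd⟩⟩

theorem extensionProperty_of_exists_orthogonal (hsymm : ∀ x y, B x y = B y x)
    (hB : B.SeparatingRight)
    (h : ∀ D : Submodule F V, D.FG → ∀ c, ∃ z, z ∉ D ∧ (∀ d ∈ D, B z d = 0) ∧ B z z = c) :
    ExtensionProperty B := by
  intro D hD l c
  obtain ⟨x, hx⟩ := exists_represents hB hD l
  obtain ⟨z, hzD, hz, hzz⟩ := h (D ⊔ F ∙ x) (hD.sup (Submodule.fg_span_singleton x)) (c - B x x)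
  have hxD : x ∈ D ⊔ F ∙ x := Submodule.mem_sup_right (Submodule.mem_span_singleton_self x)
  have hzx : B z x = 0 := hz x hxD
  refine ⟨x + z, fun hD => hzD ?_, fun d hd => ?_, ?_⟩
  · exact (Submodule.add_mem_iff_right _ hxD).1 (Submodule.mem_sup_left hD)
  · rw [map_add, LinearMap.add_apply, hx d hd, hz d (Submodule.mem_sup_left hd), add_zero]
  · simp [hzx, hsymm x z, hzz]

theorem ExtensionProperty.separatingRight (hB : ExtensionProperty B) : B.SeparatingRight := by
  intro d hd
  by_contra hne
  obtain ⟨f, hf⟩ := Module.Projective.exists_dual_ne_zero F hne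
  obtain ⟨y, -, hy, -⟩ := hB (F ∙ d) (Submodule.fg_span_singleton d) f 0
  exact hf ((hy d (Submodule.mem_span_singleton_self d)).symm.trans (hd y))

theorem exists_le_supported {ι R M : Type*} [Semiring R] [AddCommMonoid M] [Module R M]
    {D : Submodule R (ι →₀ M)} (hD : D.FG) : ∃ s : Finset ι, D ≤ Finsupp.supported M R s := by
  classical
  obtain ⟨t, rfl⟩ := hD
  refine ⟨t.biUnion Finsupp.support, Submodule.span_le.2 fun x hx => ?_⟩
  exact (Finsupp.mem_supported R x).2 (Finset.coe_subset.2 (Finset.subset_biUnion_of_mem _ hx))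

end

variable {p : ℕ}

theorem form_eq_sum (x y : ℕ →₀ ZMod p) {s : Finset ℕ} (hs : x.support ⊆ s) :
    form x y = ∑ i ∈ s, x i * y i :=
  Finset.sum_subset hs fun i _ hi => by simp [Finsupp.notMem_support_iff.1 hi]

theorem form_comm (x y : ℕ →₀ ZMod p) : form x y = form y x := by
  rw [form_eq_sum x y (s := x.support ∪ y.support) Finset.subset_union_left,
    form_eq_sum y x (s := x.support ∪ y.support) Finset.subset_union_right]
  exact Finset.sum_congr rfl fun i _ => mul_comm _ _

/-- `form` as a bilinear map. -/
noncomputable def bilinForm (p : ℕ) : (ℕ →₀ ZMod p) →ₗ[ZMod p] (ℕ →₀ ZMod p) →ₗ[ZMod p] ZMod p :=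
  have hadd (x y z : ℕ →₀ ZMod p) : form x (y + z) = form x y + form x z := by
    simp [form, mul_add, Finset.sum_add_distrib]
  have hsmul (c : ZMod p) (x y : ℕ →₀ ZMod p) : form x (c • y) = c • form x y := by
    simp [form, Finset.mul_sum, mul_left_comm]
  LinearMap.mk₂ (ZMod p) form (fun x y z => by simp only [form_comm _ z, hadd])
    (fun c x y => by simp only [form_comm _ y, hsmul]) hadd hsmul

theorem bilinForm_indicator_one (s : Finset ℕ) (y : ℕ →₀ ZMod p) :
    bilinForm p (Finsupp.indicator s fun _ _ => 1) y = ∑ i ∈ s, y i := by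
  refine (form_eq_sum _ y (Finsupp.support_indicator_subset _ _)).trans ?_
  exact Finset.sum_congr rfl fun i hi => by simp [hi]

theorem separatingRight_bilinForm : (bilinForm p).SeparatingRight := fun d hd => by
  ext i
  simpa [bilinForm_indicator_one] using hd (Finsupp.indicator {i} fun _ _ => 1)

/- A block of `r` ones outside the supports of `D` is orthogonal to `D` and has norm `r`. -/
theorem extensionProperty_bilinForm [Fact p.Prime] : ExtensionProperty (bilinForm p) := by
  refine extensionProperty_of_exists_orthogonal form_comm separatingRight_bilinForm
    fun D hD c => ?_
  obtain ⟨s, hs⟩ := exists_le_supported hD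
  obtain ⟨t, hts, ht⟩ := s.finite_toSet.infinite_compl.exists_subset_card_eq (c.val + p)
  have hzero : ∀ d ∈ D, ∀ i ∈ t, d i = 0 := fun d hd i hi =>
    (Finsupp.mem_supported' _ d).1 (hs hd) i (hts hi)
  have htne : t.Nonempty := Finset.card_pos.1 (by have := (Fact.out : p.Prime).pos; omega)
  obtain ⟨i, hi⟩ := htne
  refine ⟨Finsupp.indicator t fun _ _ => 1, fun hz => ?_, fun d hd => ?_, ?_⟩
  · simpa [hi] using hzero _ hz i hi
  · rw [bilinForm_indicator_one, Finset.sum_eq_zero (hzero d hd)]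
  · have hone : ∀ i ∈ t, Finsupp.indicator t (fun _ _ => (1 : ZMod p)) i = 1 := fun i hi => by
      simp [hi]
    rw [bilinForm_indicator_one, Finset.sum_congr rfl hone]
    simp [ht]

/-- The presentation of the standard model. -/
noncomputable def standardPresentation (p : ℕ) :
    Presentation p (ℕ →₀ ZMod p) (bilinForm p) (Carrier p) where
  equiv :=
    { toFun := Sum.elim .vec .scal
      invFun
        | .vec x => .inl x
        | .scal c => .inr c
      left_inv := by rintro (x | c) <;> rfl
      right_inv := by rintro (x | c) <;> rfl }
  zeroVec_eq := rfl
  isVec_iff _ := Iff.rfl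
  isScal_iff _ := Iff.rfl
  isAdd_iff _ _ _ := Iff.rfl
  isDot_iff _ _ _ := Iff.rfl
  symm := form_comm

end StandardModel

section Models

open FirstOrder.Language ModelDividing

section

variable {α : Type*}

theorem isElementary_eq_zeroVec (a : α) : IsElementary lang fun K _ v => v a = zeroVec K :=
  ⟨Term.equal (Term.var a) (Term.func (L := lang) Func.zero ![]), fun _ _ v =>
    Formula.realize_equal.trans (iff_of_eq (congrArg (v a = ·) (funMap_zero _)))⟩

theorem isElementary_isVec (a : α) : IsElementary lang fun _ _ v => IsVec (v a) := by
  obtain ⟨φ, hφ⟩ := IsElementary.rel (L := lang) Rel.vec ![a]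
  exact ⟨φ, fun K _ v => (hφ K v).trans (relMap_vec_iff _)⟩

theorem isElementary_isScal (a : α) : IsElementary lang fun _ _ v => IsScal (v a) := by
  obtain ⟨φ, hφ⟩ := IsElementary.rel (L := lang) Rel.scal ![a]
  exact ⟨φ, fun K _ v => (hφ K v).trans (relMap_scal_iff _)⟩

theorem isElementary_isAdd (a b c : α) :
    IsElementary lang fun _ _ v => IsAdd (v a) (v b) (v c) := by
  obtain ⟨φ, hφ⟩ := IsElementary.rel (L := lang) Rel.add ![a, b, c]
  exact ⟨φ, fun K _ v => (hφ K v).trans (relMap_add_iff _)⟩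

theorem isElementary_isDot (a b c : α) :
    IsElementary lang fun _ _ v => IsDot (v a) (v b) (v c) := by
  obtain ⟨φ, hφ⟩ := IsElementary.rel (L := lang) Rel.dot ![a, b, c]
  exact ⟨φ, fun K _ v => (hφ K v).trans (relMap_dot_iff _)⟩

end

variable {p : ℕ}

section Labelling

variable (K : Type) [lang.Structure K] (s : ZMod p → K)

/-- `s` enumerates the scalar sort, and the other elements of `K` are the vectors. -/
def LabelsScalars : Prop :=
  (∀ x : K, IsVec x ↔ ∀ c, ¬ x = s c) ∧ (∀ x : K, IsScal x ↔ ∃ c, x = s c) ∧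
    ∀ c d, s c = s d → c = d

/-- The product of `K` is a symmetric pairing of the vectors with values labelled by `s`, and it
separates the vectors. -/
def LabelsProducts : Prop :=
  (∀ x y z : K, IsDot x y z → IsVec x ∧ IsVec y ∧ IsDot y x z) ∧
    (∀ x y : K, IsVec x → IsVec y → ∃ c, ∀ z : K, IsDot x y z ↔ z = s c) ∧
    ∀ x y : K, IsVec x → IsVec y → (∀ z t : K, IsDot x z t → IsDot y z t) → x = y

/-- Products are additive with respect to the addition of `K`. -/
def ProductsAdditive : Prop :=
  (∀ x : K, x = zeroVec K → IsVec x ∧ ∀ y : K, IsVec y → IsDot x y (s 0)) ∧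
    (∀ x y : K, IsVec x → IsVec y → ∃ z : K, IsAdd x y z) ∧
    ∀ x y z : K, IsAdd x y z → IsVec x ∧ IsVec y ∧ IsVec z ∧
      ∀ (w : K) (c d : ZMod p), IsDot x w (s c) → IsDot y w (s d) → IsDot z w (s (c + d))

/-- The scalars of `K` are labelled by `s` in such a way that `K` is the disjoint union of a vector
space with a nondegenerate symmetric bilinear form and its field of scalars. -/
def IsLabelling : Prop := LabelsScalars K s ∧ LabelsProducts K s ∧ ProductsAdditive K s

/-- Any `n` vectors are orthogonal to some other vector whose product with itself is `c`. -/
def HasGenericVectors (n : ℕ) (c : ZMod p) : Prop :=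
  ∀ b : Fin n → K, (∀ i, IsVec (b i)) →
    ∃ z : K, IsDot z z (s c) ∧ ∀ i, ¬ z = b i ∧ IsDot z (b i) (s 0)

end Labelling

section Elementary

theorem isElementary_labelsScalars [NeZero p] :
    IsElementary lang fun K _ (s : ZMod p → K) => LabelsScalars K s :=
  .and (.all (.iff (isElementary_isVec _) (.forall_finite fun _ => .not (.eq _ _))))
    (.and (.all (.iff (isElementary_isScal _) (.exists_finite fun _ => .eq _ _)))
      (.forall_finite fun _ => .forall_finite fun _ => .imp (.eq _ _) (.const _)))

theorem isElementary_labelsProducts [NeZero p] :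
    IsElementary lang fun K _ (s : ZMod p → K) => LabelsProducts K s :=
  .and (.all <| .all <| .all <| .imp (isElementary_isDot _ _ _) <|
      .and (isElementary_isVec _) <| .and (isElementary_isVec _) (isElementary_isDot _ _ _)) <|
    .and (.all <| .all <| .imp (isElementary_isVec _) <| .imp (isElementary_isVec _) <|
      .exists_finite fun _ => .all <| .iff (isElementary_isDot _ _ _) (.eq _ _)) <|
    .all <| .all <| .imp (isElementary_isVec _) <| .imp (isElementary_isVec _) <| .imp
      (.all <| .all <| .imp (isElementary_isDot _ _ _) (isElementary_isDot _ _ _)) (.eq _ _)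

theorem isElementary_productsAdditive [NeZero p] :
    IsElementary lang fun K _ (s : ZMod p → K) => ProductsAdditive K s :=
  .and (.all <| .imp (isElementary_eq_zeroVec _) <| .and (isElementary_isVec _) <|
      .all <| .imp (isElementary_isVec _) (isElementary_isDot _ _ _)) <|
    .and (.all <| .all <| .imp (isElementary_isVec _) <| .imp (isElementary_isVec _) <|
      .ex (isElementary_isAdd _ _ _)) <|
    .all <| .all <| .all <| .imp (isElementary_isAdd _ _ _) <| .and (isElementary_isVec _) <|
      .and (isElementary_isVec _) <| .and (isElementary_isVec _) <| .all <|
      .forall_finite fun _ => .forall_finite fun _ => .imp (isElementary_isDot _ _ _) <|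
      .imp (isElementary_isDot _ _ _) (isElementary_isDot _ _ _)

theorem isElementary_isLabelling [NeZero p] :
    IsElementary lang fun K _ (s : ZMod p → K) => IsLabelling K s :=
  isElementary_labelsScalars.and (isElementary_labelsProducts.and isElementary_productsAdditive)

theorem isElementary_hasGenericVectors (n : ℕ) (c : ZMod p) :
    IsElementary lang fun K _ (s : ZMod p → K) => HasGenericVectors K s n c :=
  .forall_tuple <| .imp (.forall_finite fun _ => isElementary_isVec _) <| .ex <|
    .and (isElementary_isDot _ _ _) <| .forall_finite fun _ =>
      .and (.not (.eq _ _)) (isElementary_isDot _ _ _)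

end Elementary

namespace Presentation

variable {V : Type*} [AddCommGroup V] [Module (ZMod p) V]
  {B : V →ₗ[ZMod p] V →ₗ[ZMod p] ZMod p} {K : Type} [lang.Structure K]

/-- The element of `K` that is the scalar `c`. -/
def scal (P : Presentation p V B K) (c : ZMod p) : K := P.equiv (.inr c)

variable (P : Presentation p V B K)

theorem scal_injective : Function.Injective P.scal := P.equiv.injective.comp Sum.inr_injective

theorem isDot_vec_iff {x y : V} {k : K} : IsDot (P.vec x) (P.vec y) k ↔ k = P.scal (B x y) := by
  simp [P.isDot_iff, vec, scal]

theorem labelsScalars : LabelsScalars K P.scal := by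
  refine ⟨fun k => ?_, P.isScal_iff, fun c d h => P.scal_injective h⟩
  obtain ⟨x | c, rfl⟩ := P.equiv.surjective k <;> simp [P.isVec_iff, scal]

theorem labelsProducts (hB : B.SeparatingRight) : LabelsProducts K P.scal := by
  refine ⟨fun k l m h => ?_, fun k l hk hl => ?_, fun k l hk hl h => ?_⟩
  · obtain ⟨x, y, rfl, rfl, rfl⟩ := (P.isDot_iff k l m).1 h
    exact ⟨P.isVec_vec x, P.isVec_vec y, P.isDot_vec_iff.2 (congrArg P.scal (P.symm x y))⟩
  · obtain ⟨x, rfl⟩ := (P.isVec_iff k).1 hk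
    obtain ⟨y, rfl⟩ := (P.isVec_iff l).1 hl
    exact ⟨B x y, fun _ => P.isDot_vec_iff⟩
  · obtain ⟨x, rfl⟩ := (P.isVec_iff k).1 hk
    obtain ⟨y, rfl⟩ := (P.isVec_iff l).1 hl
    refine congrArg P.vec (sub_eq_zero.1 (hB _ fun z => ?_))
    have hz := P.isDot_vec_iff.1 (h (P.vec z) _ (P.isDot_vec_iff.2 rfl))
    have hxy : B x z = B y z := P.scal_injective hz
    rw [map_sub, P.symm z x, P.symm z y, hxy, sub_self]

theorem productsAdditive : ProductsAdditive K P.scal := by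
  refine ⟨?_, fun k l hk hl => ?_, fun k l m h => ?_⟩
  · rintro k hk
    obtain rfl : k = P.vec 0 := hk.trans P.zeroVec_eq
    refine ⟨P.isVec_vec 0, fun l hl => ?_⟩
    obtain ⟨y, rfl⟩ := (P.isVec_iff l).1 hl
    exact P.isDot_vec_iff.2 (by simp)
  · obtain ⟨x, rfl⟩ := (P.isVec_iff k).1 hk
    obtain ⟨y, rfl⟩ := (P.isVec_iff l).1 hl
    exact ⟨_, P.isAdd_vec_iff.2 rfl⟩
  · obtain ⟨x, y, rfl, rfl, rfl⟩ := (P.isAdd_iff k l m).1 h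
    refine ⟨P.isVec_vec x, P.isVec_vec y, P.isVec_vec (x + y), fun w c d hc hd => ?_⟩
    obtain ⟨-, z, -, rfl, -⟩ := (P.isDot_iff _ w _).1 hc
    have hxc := P.isDot_vec_iff.1 hc
    have hyd := P.isDot_vec_iff.1 hd
    obtain rfl : c = B x z := P.scal_injective hxc
    obtain rfl : d = B y z := P.scal_injective hyd
    exact P.isDot_vec_iff.2 (by simp)

theorem isLabelling [Fact p.Prime] (hB : ExtensionProperty B) : IsLabelling K P.scal :=
  ⟨P.labelsScalars, P.labelsProducts hB.separatingRight, P.productsAdditive⟩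

theorem hasGenericVectors (hB : ExtensionProperty B) (n : ℕ) (c : ZMod p) :
    HasGenericVectors K P.scal n c := by
  intro b hb
  choose x hx using fun i => (P.isVec_iff (b i)).1 (hb i)
  obtain rfl : b = fun i => P.vec (x i) := funext hx
  obtain ⟨z, hz, hzx, hzz⟩ := hB (Submodule.span _ (Set.range x))
    (Submodule.fg_span (Set.finite_range x)) 0 c
  have hxi (i : Fin n) := Submodule.subset_span (R := ZMod p) (Set.mem_range_self (f := x) i)
  refine ⟨P.vec z, P.isDot_vec_iff.2 (by rw [hzz]), fun i => ⟨fun h => hz ?_, ?_⟩⟩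
  · exact P.vec_injective h ▸ hxi i
  · exact P.isDot_vec_iff.2 (by rw [hzx _ (hxi i), LinearMap.zero_apply])

end Presentation

theorem exists_linear_structure {X : Type*} [NeZero p] {d : X → X → ZMod p}
    (hd : Function.Injective d) (hsymm : ∀ x y, d x y = d y x) (hzero : 0 ∈ Set.range d)
    (hadd : ∀ x y, d x + d y ∈ Set.range d) :
    ∃ (V : Submodule (ZMod p) (X → ZMod p)) (B : V →ₗ[ZMod p] V →ₗ[ZMod p] ZMod p) (e : X ≃ V),
      (∀ x y, B (e x) (e y) = d x y) ∧ ∀ x, (e x : X → ZMod p) = d x := by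
  let M : AddSubmonoid (X → ZMod p) :=
    { carrier := Set.range d
      zero_mem' := hzero
      add_mem' := by
        rintro _ _ ⟨x, rfl⟩ ⟨y, rfl⟩
        exact hadd x y }
  let V : Submodule (ZMod p) (X → ZMod p) :=
    { M with
      smul_mem' := fun c u hu => by
        rw [← ZMod.natCast_zmod_val c, Nat.cast_smul_eq_nsmul]
        exact M.nsmul_mem hu c.val }
  let e : X ≃ V := Equiv.ofInjective d hd
  have he (x : X) : (e x : X → ZMod p) = d x := rfl
  have happ (u v : V) : (u : X → ZMod p) (e.symm v) = (v : X → ZMod p) (e.symm u) := by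
    obtain ⟨x, rfl⟩ := e.surjective u
    obtain ⟨y, rfl⟩ := e.surjective v
    rw [e.symm_apply_apply, e.symm_apply_apply, he, he, hsymm]
  refine ⟨V, LinearMap.mk₂ _ (fun u v => (u : X → ZMod p) (e.symm v)) (fun _ _ _ => rfl)
    (fun _ _ _ => rfl) (fun u v w => ?_) (fun c u v => ?_), e, fun x y => ?_, he⟩
  · rw [happ, happ u v, happ u w]
    rfl
  · rw [happ, happ u v]
    rfl
  · rw [LinearMap.mk₂_apply, e.symm_apply_apply, he]

namespace IsLabelling

variable {K : Type} [lang.Structure K] {s : ZMod p → K}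

theorem exists_product (h : IsLabelling K s) :
    ∃ d : {x : K // IsVec x} → {x : K // IsVec x} → ZMod p, Function.Injective d ∧
      (∀ x y, d x y = d y x) ∧
      ∀ (x y : {x : K // IsVec x}) t, IsDot (x : K) y t ↔ t = s (d x y) := by
  obtain ⟨⟨-, -, hs⟩, ⟨hdot, hval, hext⟩, -⟩ := h
  choose d hd using fun x y : {x : K // IsVec x} => hval x y x.2 y.2
  refine ⟨d, fun x y hxy => Subtype.ext (hext x y x.2 y.2 fun z t hz => ?_), fun x y => ?_, hd⟩
  · have hzt := (hd x ⟨z, (hdot _ _ _ hz).2.1⟩ t).1 hz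
    exact (hd y ⟨z, _⟩ t).2 (hxy ▸ hzt)
  · exact hs _ _ ((hd y x _).1 (hdot _ _ _ ((hd x y _).2 rfl)).2.2)

variable {d : {x : K // IsVec x} → {x : K // IsVec x} → ZMod p}

theorem isVec_zeroVec (h : IsLabelling K s) : IsVec (zeroVec K) := (h.2.2.1 _ rfl).1

theorem product_zeroVec (h : IsLabelling K s)
    (hd : ∀ (x y : {x : K // IsVec x}) t, IsDot (x : K) y t ↔ t = s (d x y)) :
    d ⟨zeroVec K, h.isVec_zeroVec⟩ = 0 :=
  funext fun y => (h.1.2.2 _ _ ((hd _ y _).1 ((h.2.2.1 _ rfl).2 y y.2))).symm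

theorem product_add (h : IsLabelling K s)
    (hd : ∀ (x y : {x : K // IsVec x}) t, IsDot (x : K) y t ↔ t = s (d x y))
    {x y z : {x : K // IsVec x}} (hz : IsAdd (x : K) y z) : d x + d y = d z :=
  funext fun w => h.1.2.2 _ _ ((hd z w _).1
    ((h.2.2.2.2 _ _ _ hz).2.2.2 w _ _ ((hd x w _).2 rfl) ((hd y w _).2 rfl)))

theorem isAdd_iff (h : IsLabelling K s) (hinj : Function.Injective d)
    (hd : ∀ (x y : {x : K // IsVec x}) t, IsDot (x : K) y t ↔ t = s (d x y))
    {x y z : {x : K // IsVec x}} : IsAdd (x : K) y z ↔ d x + d y = d z := by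
  refine ⟨h.product_add hd, fun hz => ?_⟩
  obtain ⟨w, hw⟩ := h.2.2.2.1 x y x.2 y.2
  have hwz : ⟨w, (h.2.2.2.2 _ _ _ hw).2.2.1⟩ = z := hinj ((h.product_add hd hw).symm.trans hz)
  exact hwz ▸ hw

/-- The decomposition of a labelled structure into vectors and scalars. -/
noncomputable def equiv (h : IsLabelling K s) : {x : K // IsVec x} ⊕ ZMod p ≃ K :=
  Equiv.ofBijective (Sum.elim Subtype.val s) <| by
    refine ⟨Subtype.val_injective.sumElim (fun c d => h.1.2.2 c d)
      fun x c => (h.1.1 x).1 x.2 c, fun k => ?_⟩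
    by_cases hk : ∃ c, k = s c
    · obtain ⟨c, rfl⟩ := hk
      exact ⟨.inr c, rfl⟩
    · exact ⟨.inl ⟨k, (h.1.1 k).2 (not_exists.1 hk)⟩, rfl⟩

@[simp] theorem equiv_inl (h : IsLabelling K s) (x : {x : K // IsVec x}) :
    h.equiv (.inl x) = x := rfl

@[simp] theorem equiv_inr (h : IsLabelling K s) (c : ZMod p) : h.equiv (.inr c) = s c := rfl

/-- The presentation given by a linear structure on the vectors of a labelled structure. -/
noncomputable def presentation {V : Type*} [AddCommGroup V] [Module (ZMod p) V]
    {B : V →ₗ[ZMod p] V →ₗ[ZMod p] ZMod p} (h : IsLabelling K s) {e : {x : K // IsVec x} ≃ V}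
    (hsymm : ∀ u v, B u v = B v u) (hzero : e ⟨zeroVec K, h.isVec_zeroVec⟩ = 0)
    (hadd : ∀ x y z : {x : K // IsVec x}, IsAdd (x : K) y z ↔ e x + e y = e z)
    (hdot : ∀ (x y : {x : K // IsVec x}) t, IsDot (x : K) y t ↔ t = s (B (e x) (e y))) :
    Presentation p V B K where
  equiv := (e.symm.sumCongr (Equiv.refl _)).trans h.equiv
  zeroVec_eq := by simp [← hzero]
  isVec_iff k := ⟨fun hk => ⟨e ⟨k, hk⟩, by simp⟩, fun ⟨u, hu⟩ => hu ▸ (e.symm u).2⟩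
  isScal_iff := h.1.2.1
  isAdd_iff k l m := by
    constructor
    · intro hm
      obtain ⟨hk, hl, hm', -⟩ := h.2.2.2.2 k l m hm
      have hsum := (hadd ⟨k, hk⟩ ⟨l, hl⟩ ⟨m, hm'⟩).1 hm
      exact ⟨e ⟨k, hk⟩, e ⟨l, hl⟩, by simp, by simp, by simp [hsum]⟩
    · rintro ⟨u, v, rfl, rfl, rfl⟩
      exact (hadd (e.symm u) (e.symm v) (e.symm (u + v))).2 (by simp)
  isDot_iff k l m := by
    constructor
    · intro hm
      obtain ⟨hk, hl, -⟩ := h.2.1.1 k l m hm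
      exact ⟨e ⟨k, hk⟩, e ⟨l, hl⟩, by simp, by simp, (hdot ⟨k, hk⟩ ⟨l, hl⟩ m).1 hm⟩
    · rintro ⟨u, v, rfl, rfl, rfl⟩
      exact (hdot (e.symm u) (e.symm v) _).2 (by simp)
  symm := hsymm

theorem exists_presentation [NeZero p] (h : IsLabelling K s) :
    ∃ (V : Type) (_ : AddCommGroup V) (_ : Module (ZMod p) V)
      (B : V →ₗ[ZMod p] V →ₗ[ZMod p] ZMod p) (P : Presentation p V B K),
      P.scal = s ∧ B.SeparatingRight := by
  obtain ⟨d, hinj, hsymm, hd⟩ := h.exists_product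
  obtain ⟨V, B, e, hB, he⟩ := exists_linear_structure hinj hsymm ⟨_, h.product_zeroVec hd⟩
    fun x y => by
      obtain ⟨z, hz⟩ := h.2.2.2.1 x y x.2 y.2
      exact ⟨⟨z, (h.2.2.2.2 _ _ _ hz).2.2.1⟩, (h.product_add hd hz).symm⟩
  have hBsymm (u v : V) : B u v = B v u := by
    obtain ⟨x, rfl⟩ := e.surjective u
    obtain ⟨y, rfl⟩ := e.surjective v
    rw [hB, hB, hsymm]
  refine ⟨V, inferInstance, inferInstance, B, h.presentation (e := e) hBsymm
    (Subtype.ext ((he _).trans (h.product_zeroVec hd)))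
    (fun x y z => ?_) (fun x y t => hB x y ▸ hd x y t), rfl, fun v hv => ?_⟩
  · rw [h.isAdd_iff hinj hd, ← he, ← he, ← he, ← Submodule.coe_add, Subtype.coe_inj]
  · refine Subtype.ext (funext fun x => ?_)
    obtain ⟨y, rfl⟩ := e.surjective v
    rw [he, ← hB, hBsymm, hv]
    rfl

end IsLabelling

theorem Presentation.extensionProperty [Fact p.Prime] {V : Type*} [AddCommGroup V]
    [Module (ZMod p) V] {B : V →ₗ[ZMod p] V →ₗ[ZMod p] ZMod p} {K : Type} [lang.Structure K]
    (P : Presentation p V B K) (hB : B.SeparatingRight)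
    (h : ∀ n c, HasGenericVectors K P.scal n c) : ExtensionProperty B := by
  refine extensionProperty_of_exists_orthogonal P.symm hB fun D hD c => ?_
  have : Finite D := finite_of_fg hD
  obtain ⟨n, ⟨e⟩⟩ := Finite.exists_equiv_fin D
  obtain ⟨k, hk, hkD⟩ := h n c (fun i => P.vec (e.symm i : V)) fun i => P.isVec_vec _
  obtain ⟨z, -, rfl, -⟩ := (P.isDot_iff k k _).1 hk
  refine ⟨z, fun hz => (hkD (e ⟨z, hz⟩)).1 (by simp [vec]), fun x hx => ?_,
    (P.scal_injective (P.isDot_vec_iff.1 hk)).symm⟩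
  have hzx := (hkD (e ⟨x, hx⟩)).2
  rw [e.symm_apply_apply] at hzx
  exact (P.scal_injective (P.isDot_vec_iff.1 hzx)).symm

theorem exists_presentation (p : ℕ) [Fact p.Prime] (N : Type) [lang.Structure N]
    [N ⊨ theory p] :
    ∃ (V : Type) (_ : AddCommGroup V) (_ : Module (ZMod p) V)
      (B : V →ₗ[ZMod p] V →ₗ[ZMod p] ZMod p) (_ : Presentation p V B N), ExtensionProperty B := by
  have : N ⊨ lang.completeTheory (Carrier p) := ‹N ⊨ theory p›
  have hM := (standardPresentation p).isLabelling extensionProperty_bilinForm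
  obtain ⟨s₀, hs₀⟩ := isElementary_isLabelling.exists_of_completeTheory (N := N) hM
  have hfin : {s : ZMod p → N | IsLabelling N s}.Finite := by
    refine (Set.Finite.pi' fun _ : ZMod p => Set.finite_range s₀).subset fun s hs c => ?_
    obtain ⟨d, hd⟩ := (hs₀.1.2.1 (s c)).1 ((hs.1.2.1 (s c)).2 ⟨c, rfl⟩)
    exact ⟨d, hd.symm⟩
  obtain ⟨s, hs, hall⟩ := isElementary_isLabelling.exists_same_type hM hfin
  obtain ⟨V, _, _, B, P, rfl, hB⟩ := hs.exists_presentation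
  exact ⟨V, _, _, B, P, P.extensionProperty hB fun n c =>
    hall _ (isElementary_hasGenericVectors n c)
      ((standardPresentation p).hasGenericVectors extensionProperty_bilinForm n c)⟩

end Models

section TwoDependence

open FirstOrder.Language ModelDividing

theorem natCard_linearMap {F E W : Type*} [Field F] [AddCommGroup E] [Module F E]
    [FiniteDimensional F E] [AddCommGroup W] [Module F W] [FiniteDimensional F W] :
    Nat.card (E →ₗ[F] W →ₗ[F] F) = Nat.card F ^ (Module.finrank F E * Module.finrank F W) := by
  rw [Module.natCard_eq_pow_finrank (K := F), Module.finrank_linearMap, Module.finrank_linearMap,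
    Module.finrank_self, mul_one]

theorem natCard_typeCode {F E A : Type*} [Field F] [Finite F] [AddCommGroup E] [Module F E]
    [FiniteDimensional F E] [AddCommGroup A] [Module F A] [FiniteDimensional F A] :
    Nat.card ((E →ₗ[F] E →ₗ[F] F) × (E →ₗ[F] A →ₗ[F] F) × (E → Option A)) =
      Nat.card F ^ (Module.finrank F E * Module.finrank F E) *
        (Nat.card F ^ (Module.finrank F E * Module.finrank F A) *
          (Nat.card F ^ Module.finrank F A + 1) ^ Nat.card F ^ Module.finrank F E) := by
  have : Finite A := Module.finite_of_finite F
  have : Finite E := Module.finite_of_finite F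
  rw [Nat.card_prod, Nat.card_prod, natCard_linearMap, natCard_linearMap, Nat.card_fun,
    Finite.card_option, ← Module.natCard_eq_pow_finrank, ← Module.natCard_eq_pow_finrank]

theorem typeBound_le {p : ℕ} (hp : 2 ≤ p) (m r : ℕ) :
    (p + 1) ^ m * (p ^ (m * m) * (p ^ (m * r) * (p ^ r + 1) ^ p ^ m)) ≤
      p ^ ((m * m + 3 * m + p ^ m) * (r + 1)) := by
  have hpow (n : ℕ) : p ^ n + 1 ≤ p ^ (n + 1) := by
    have : 0 < p ^ n := Nat.pow_pos (by omega)
    rw [pow_succ]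
    nlinarith
  calc (p + 1) ^ m * (p ^ (m * m) * (p ^ (m * r) * (p ^ r + 1) ^ p ^ m))
      ≤ (p ^ 2) ^ m * (p ^ (m * m) * (p ^ (m * r) * (p ^ (r + 1)) ^ p ^ m)) := by
        gcongr
        · simpa using hpow 1
        · exact hpow r
    _ = p ^ (2 * m + (m * m + (m * r + (r + 1) * p ^ m))) := by
        rw [← pow_mul, ← pow_mul, ← pow_add, ← pow_add, ← pow_add]
    _ ≤ p ^ ((m * m + 3 * m + p ^ m) * (r + 1)) :=
        Nat.pow_le_pow_right (by omega) (by nlinarith [Nat.zero_le (m * m * r)])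

theorem Presentation.natCard_le_of_injective_type {p : ℕ} [Fact p.Prime] {V : Type*}
    [AddCommGroup V] [Module (ZMod p) V] {B : V →ₗ[ZMod p] V →ₗ[ZMod p] ZMod p} {K : Type}
    [lang.Structure K] (P : Presentation p V B K) (hB : ExtensionProperty B) {κ α τ : Type*}
    [Fintype κ] [Fintype α] (g : κ → K) (b : τ → α → K)
    (hb : Function.Injective fun t => {φ : lang.Formula (κ ⊕ α) | φ.Realize (Sum.elim g (b t))}) :
    Nat.card τ ≤ p ^ ((Fintype.card α * Fintype.card α + 3 * Fintype.card α +
      p ^ Fintype.card α) * (Fintype.card κ + 1)) := by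
  classical
  let A : Submodule (ZMod p) V := LinearMap.range (P.comb g)
  have hA : A.FG := Module.Finite.iff_fg.1 inferInstance
  have hrank : Module.finrank (ZMod p) A ≤ Fintype.card κ := by
    simpa using LinearMap.finrank_range_le (P.comb g)
  let code (t : τ) := (fun i => P.scalPart (b t i), typeCode B A (P.comb (b t)))
  have hcode : Function.Injective code := fun t t' h => hb <| Set.ext fun φ =>
    P.realize_sumElim_iff_of_sameTypeOver hB hA φ (P.vecPart_mem_range_comb g)
      (congrFun (congrArg Prod.fst h)) (sameTypeOver_of_typeCode_eq (congrArg Prod.snd h))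
  have : Finite A := finite_of_fg hA
  have : Finite ((α → ZMod p) →ₗ[ZMod p] (α → ZMod p) →ₗ[ZMod p] ZMod p) :=
    Module.finite_of_finite (ZMod p)
  have : Finite ((α → ZMod p) →ₗ[ZMod p] A →ₗ[ZMod p] ZMod p) := Module.finite_of_finite (ZMod p)
  refine (Nat.card_le_card_of_injective code hcode).trans ?_
  rw [Nat.card_prod, Nat.card_fun, Finite.card_option, Nat.card_zmod, Nat.card_eq_fintype_card,
    natCard_typeCode, Nat.card_zmod, Module.finrank_fintype_fun_eq_card]
  have hp : 2 ≤ p := (Fact.out : p.Prime).two_le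
  refine le_trans ?_ (typeBound_le hp _ _)
  gcongr <;> omega

theorem isDependent_two (p : ℕ) [Fact p.Prime] : ModelDividing.IsDependent 2 (theory p) := by
  rintro ⟨k, m, ψ, hψ⟩
  obtain ⟨N, hN⟩ := hψ.exists_injective_type
  obtain ⟨V, _, _, B, P, hB⟩ := exists_presentation p N
  have hcount (n : ℕ) : n * n ≤ p * ((m * m + 3 * m + p ^ m) * (n * (k 0 + k 1) + 1)) := by
    obtain ⟨g, b, hb⟩ := hN n
    have hcard := P.natCard_le_of_injective_type hB g b hb
    simp only [Nat.card_eq_fintype_card, Fintype.card_set, Fintype.card_fun, Fintype.card_fin,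
      Fintype.card_sigma, Fintype.card_prod, Fin.sum_univ_two, ← mul_add, sq] at hcard
    rw [← Nat.pow_le_pow_iff_right Nat.one_lt_two, pow_mul 2 p]
    exact hcard.trans (Nat.pow_le_pow_left Nat.lt_two_pow_self.le _)
  have hlarge := hcount (p * ((m * m + 3 * m + p ^ m) * (k 0 + k 1 + 1)) + 1)
  generalize m * m + 3 * m + p ^ m = c at hlarge
  generalize k 0 + k 1 = r at hlarge
  nlinarith [Nat.zero_le (p * c), Nat.zero_le (p * c * r)]

end TwoDependence

section Simplicity

open FirstOrder.Language ModelDividing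

namespace Presentation

variable {p : ℕ} {V : Type*} [AddCommGroup V] [Module (ZMod p) V]
  {B : V →ₗ[ZMod p] V →ₗ[ZMod p] ZMod p} {K : Type} [lang.Structure K]
  (P : Presentation p V B K) {α β ι : Type*} [Fintype α] [Fintype β]

theorem exists_comb_eq_of_sameTypeOver {A : Submodule (ZMod p) V} {x : α → K}
    {z : (α → ZMod p) →ₗ[ZMod p] V} (h : SameTypeOver B A (P.comb x) z) :
    ∃ y, (∀ i, P.scalPart (y i) = P.scalPart (x i)) ∧ P.comb y = z := by
  classical
  choose y hys hyv using fun i => P.exists_parts (x i) (z (Pi.single i 1)) fun hi =>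
    (h.relation _ 0 A.zero_mem).1 ((P.comb_single x i).trans hi)
  refine ⟨y, hys, LinearMap.pi_ext' fun i => LinearMap.ext_ring ?_⟩
  simp [comb_single, hyv]

theorem exists_common_solution [Fact p.Prime] (hB : ExtensionProperty B)
    (φ : lang.Formula (α ⊕ β)) {A : Submodule (ZMod p) V} (hA : A.FG) {I : Set ι} (hI : I.Infinite)
    {x : ι → α → K} {a : ι → β → K} (hφ : ∀ i ∈ I, φ.Realize (Sum.elim (x i) (a i)))
    (hrel : ∀ i ∈ I, ∀ e, P.comb (x i) e ∈ LinearMap.range (P.comb (a i)) → P.comb (x i) e ∈ A)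
    (k : ℕ) :
    ∃ s : Finset ι, s.card = k ∧ ∃ y : α → K, ∀ i ∈ s, φ.Realize (Sum.elim y (a i)) := by
  classical
  obtain ⟨J, hJI, hJ, c, hc⟩ := exists_infinite_subset_const hI fun i j => P.scalPart (x i j)
  obtain ⟨s, hs, hsJ, z, hz⟩ := exists_common_copy hB P.symm hA hJ (fun i => P.comb (x i))
    (fun i => P.comb (a i)) (fun i hi => hrel i (hJI hi)) k
  obtain rfl | ⟨i₀, hi₀⟩ := s.eq_empty_or_nonempty
  · exact ⟨∅, hs, fun _ => P.vec 0, by simp⟩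
  obtain ⟨y, hys, rfl⟩ := P.exists_comb_eq_of_sameTypeOver (hz i₀ hi₀)
  have hscal (i) (hi : i ∈ s) (j) : P.scalPart (x i j) = P.scalPart (y j) :=
    (congrFun ((hc i (hsJ hi)).trans (hc i₀ (hsJ hi₀)).symm) j).trans (hys j).symm
  refine ⟨s, hs, y, fun i hi => ?_⟩
  have h := P.realize_sumElim_iff_of_sameTypeOver hB (Module.Finite.iff_fg.1 inferInstance)
    (φ.relabel Sum.swap) (P.vecPart_mem_range_comb (a i)) (hscal i hi) (hz i hi)
  simp only [Formula.realize_relabel, Sum.elim_swap] at h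
  exact h.1 (hφ i (hJI (hsJ hi)))

end Presentation

theorem isSimpleTheory (p : ℕ) [Fact p.Prime] : IsSimpleTheory (theory p) := by
  rintro m l φ ⟨N, k, a, -, hbranch, hnode⟩
  obtain ⟨V, _, _, B, P, hB⟩ := exists_presentation p N
  let A (s : List ℕ) : Submodule (ZMod p) V :=
    ⨆ t ∈ s.inits.toFinset, LinearMap.range (P.comb (a t))
  have hA (s) : (A s).FG := Submodule.fg_biSup _ _ fun t _ => Module.Finite.iff_fg.1 inferInstance
  have hrange (s) : LinearMap.range (P.comb (a s)) ≤ A s :=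
    le_biSup (fun t => LinearMap.range (P.comb (a t))) (by simp)
  have hmono (s) (i : ℕ) : A s ≤ A (s ++ [i]) := biSup_mono fun t ht => by
    rw [List.mem_toFinset, List.mem_inits] at ht ⊢
    exact ht.trans (List.prefix_append _ _)
  obtain ⟨s, I, hI, hsol⟩ := exists_infinite_stable_children
    (Φ := fun x s => φ.Realize (Sum.elim x (a s)))
    (r := fun x s => Module.finrank (ZMod p) ((A s).comap (P.comb x))) (m := m)
    (fun x s => (Submodule.finrank_le _).trans_eq (Module.finrank_fin_fun _)) hbranch
  have : Nonempty N := ⟨P.vec 0⟩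
  choose! x hφ hr using hsol
  obtain ⟨J, hJ, y, hy⟩ := P.exists_common_solution hB φ (hA s) hI hφ (fun i hi e he => by
    rw [← Submodule.mem_comap, Submodule.eq_of_le_of_finrank_le
      (Submodule.comap_mono (hmono s i)) (hr i hi)]
    exact hrange (s ++ [i]) he) k
  exact hnode s J hJ ⟨y, hy⟩

end Simplicity

open FirstOrder.Language ModelDividing in
theorem hasIP_one (p : ℕ) [Fact p.Prime] : HasIP 1 (theory p) := by
  classical
  let P := standardPresentation p
  have : Nonempty (Carrier p) := ⟨P.vec 0⟩
  obtain ⟨ψ, hψ⟩ := isElementary_isDot (α := (Σ _ : Fin 1, Fin 1) ⊕ Fin 2) (.inl ⟨0, 0⟩) (.inr 0)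
    (.inr 1)
  let b (I : Set (Fin 1 → ℕ)) (n : ℕ) : ℕ →₀ ZMod p :=
    Finsupp.indicator (Finset.range n) fun i _ => if (fun _ => i) ∈ I then 1 else 0
  refine ⟨fun _ => 1, 2, ψ, .of_eventually (fun _ i _ => P.vec (Finsupp.single i 1))
    (fun I n => ![P.vec (b I n), P.scal 1]) fun I i => ?_⟩
  filter_upwards [Filter.eventually_gt_atTop (i 0)] with n hn
  have hi : (fun _ => i 0) = i := funext fun j => congrArg i (Subsingleton.elim _ _)
  have hb : bilinForm p (Finsupp.single (i 0) 1) (b I n) = if i ∈ I then 1 else 0 := by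
    rw [← hi]
    refine (form_eq_sum _ _ Finsupp.support_single_subset).trans ?_
    simp [b, hn]
  rw [hψ]
  calc IsDot (P.vec (Finsupp.single (i 0) 1)) (P.vec (b I n)) (P.scal 1)
      ↔ P.scal 1 = P.scal (if i ∈ I then 1 else 0) := by rw [P.isDot_vec_iff, hb]
    _ ↔ i ∈ I := by simp [P.scal_injective.eq_iff]

section Subgroups

open FirstOrder.Language ModelDividing Cardinal
open scoped Pointwise

theorem exists_injective_quotient_inf {G : Type*} [AddCommGroup G] (S T : AddSubgroup G) :
    ∃ g : G ⧸ (S ⊓ T) → (G ⧸ S) × (G ⧸ T), Function.Injective g := by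
  have hker : ((QuotientAddGroup.mk' S).prod (QuotientAddGroup.mk' T)).ker = S ⊓ T := by
    rw [AddMonoidHom.ker_prod, QuotientAddGroup.ker_mk', QuotientAddGroup.ker_mk']
  rw [← hker]
  exact ⟨_, QuotientAddGroup.kerLift_injective _⟩

theorem ne_bot_of_mk_quotient_lt {G : Type*} [AddCommGroup G] {S : AddSubgroup G}
    (h : #(G ⧸ S) < #G) : S ≠ ⊥ := by
  rintro rfl
  exact h.ne (mk_congr QuotientAddGroup.quotientBot.toEquiv)

namespace ExtensionProperty

variable {F V : Type*} [Field F] [AddCommGroup V] [Module F V] {B : V →ₗ[F] V →ₗ[F] F}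

theorem infinite (hB : ExtensionProperty B) : Infinite V := by
  by_contra h
  rw [not_infinite_iff_finite] at h
  obtain ⟨y, hy, -⟩ := hB ⊤ Module.Finite.fg_top 0 0
  exact hy trivial

theorem exists_isotropic (hB : ExtensionProperty B) : ∃ w ≠ 0, B w w = 0 := by
  obtain ⟨w, hw, -, hww⟩ := hB ⊥ Submodule.fg_bot 0 0
  exact ⟨w, hw, hww⟩

/- For nonzero `x ∈ S` there is `y ∉ ⟨x⟩` with `B y y = B y x = B x x`, so that `y ∈ S` and `x - y`
is a nonzero isotropic vector. -/
theorem isotropic_mem (hB : ExtensionProperty B) (hsymm : ∀ u v, B u v = B v u) {S : AddSubgroup V}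
    (hS : S ≠ ⊥) (hinv : ∀ x y, x ≠ 0 → y ≠ 0 → B x x = B y y → x ∈ S → y ∈ S) {w : V}
    (hw : B w w = 0) : w ∈ S := by
  obtain rfl | hw0 := eq_or_ne w 0
  · exact S.zero_mem
  obtain ⟨⟨x, hxS⟩, hx⟩ := S.ne_bot_iff_exists_ne_zero.1 hS
  have hx0 : x ≠ 0 := fun h => hx (Subtype.ext h)
  have hxx : x ∈ F ∙ x := Submodule.mem_span_singleton_self x
  obtain ⟨y, hy, hyx, hyy⟩ := hB (F ∙ x) (Submodule.fg_span_singleton x) (B x) (B x x)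
  have hy0 : y ≠ 0 := fun h => hy (h ▸ Submodule.zero_mem _)
  have hxy : x - y ≠ 0 := fun h => hy (sub_eq_zero.1 h ▸ hxx)
  have hnorm : B (x - y) (x - y) = 0 := by simp [hsymm x y, hyx x hxx, hyy]
  exact hinv _ w hxy hw0 (hnorm.trans hw.symm) (S.sub_mem hxS (hinv x y hx0 hy0 hyy.symm hxS))

end ExtensionProperty

theorem sameTypeOver_toSpanSingleton {F V : Type*} [Field F] [AddCommGroup V] [Module F V]
    {B : V →ₗ[F] V →ₗ[F] F} {x y : V} (hx : x ≠ 0) (hy : y ≠ 0) (hxy : B x x = B y y) :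
    SameTypeOver B ⊥ (LinearMap.toSpanSingleton F V x) (LinearMap.toSpanSingleton F V y) where
  gram e e' := by simp [hxy]
  inner e c hc := by simp [(Submodule.mem_bot F).1 hc]
  relation e c hc := by simp [(Submodule.mem_bot F).1 hc, hx, hy]

theorem IsSubgroup.inter {K : Type} [lang.Structure K] {H H' : Set K} (hH : IsSubgroup H)
    (hH' : IsSubgroup H') : IsSubgroup (H ∩ H') :=
  ⟨fun x hx => hH.1 x hx.1, ⟨hH.2.1, hH'.2.1⟩,
    fun x hx y hy z hz => ⟨hH.2.2.1 x hx.1 y hy.1 z hz, hH'.2.2.1 x hx.2 y hy.2 z hz⟩,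
    fun x hx y hy => ⟨hH.2.2.2 x hx.1 y hy, hH'.2.2.2 x hx.2 y hy⟩⟩

namespace Presentation

section

variable {p : ℕ} {V : Type*} [AddCommGroup V] [Module (ZMod p) V]
  {B : V →ₗ[ZMod p] V →ₗ[ZMod p] ZMod p} {K : Type} [lang.Structure K] (P : Presentation p V B K)

theorem isSubgroup_iff {H : Set K} : IsSubgroup H ↔ ∃ S : AddSubgroup V, H = P.vec '' S := by
  have hzero : zeroVec K = P.vec 0 := P.zeroVec_eq
  constructor
  · rintro ⟨hvec, hzeroH, hadd, hneg⟩
    refine ⟨{ carrier := P.vec ⁻¹' H, zero_mem' := ?_, add_mem' := ?_, neg_mem' := ?_ }, ?_⟩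
    · exact fun hx hy => hadd _ hx _ hy _ (P.isAdd_vec_iff.2 rfl)
    · rwa [Set.mem_preimage, ← hzero]
    · exact fun {x} hx => hneg _ hx _ (P.isAdd_vec_iff.2 (by rw [add_neg_cancel, hzero]))
    · exact (Set.image_preimage_eq_of_subset fun k hk => ((P.isVec_iff k).1 (hvec k hk)).imp
        fun _ => Eq.symm).symm
  · rintro ⟨S, rfl⟩
    refine ⟨?_, ⟨0, S.zero_mem, hzero.symm⟩, ?_, ?_⟩
    · rintro _ ⟨x, -, rfl⟩
      exact P.isVec_vec x
    · rintro _ ⟨x, hx, rfl⟩ _ ⟨y, hy, rfl⟩ _ hz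
      exact ⟨x + y, S.add_mem hx hy, (P.isAdd_vec_iff.1 hz).symm⟩
    · rintro _ ⟨x, hx, rfl⟩ k hk
      obtain ⟨-, y, -, rfl, -⟩ := (P.isAdd_iff _ _ _).1 hk
      have hxy : 0 = x + y := P.vec_injective (hzero.symm.trans (P.isAdd_vec_iff.1 hk))
      exact ⟨y, eq_neg_of_add_eq_zero_right hxy.symm ▸ S.neg_mem hx, rfl⟩

theorem nonempty_cosets_equiv (S : AddSubgroup V) : Nonempty (cosets (P.vec '' S) ≃ V ⧸ S) := by
  let coset (g : V) : Set K := P.vec '' (g +ᵥ (S : Set V))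
  have hset (g : V) : {z | ∃ h ∈ P.vec '' S, IsAdd (P.vec g) h z} = coset g := by
    ext z
    simp [coset, P.isAdd_vec_iff, Set.mem_vadd_set, eq_comm]
  have hcosets : cosets (P.vec '' S) = Set.range coset := by
    ext C
    constructor
    · rintro ⟨g, hg, rfl⟩
      obtain ⟨x, rfl⟩ := (P.isVec_iff g).1 hg
      exact ⟨x, (hset x).symm⟩
    · rintro ⟨x, rfl⟩
      exact ⟨P.vec x, P.isVec_vec x, (hset x).symm⟩
  have hcoset (g g' : V) : QuotientAddGroup.leftRel S g g' ↔ coset g = coset g' := by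
    rw [P.vec_injective.image_injective.eq_iff, leftAddCoset_eq_iff, QuotientAddGroup.leftRel_apply]
  exact ⟨(Equiv.setCongr hcosets).trans
    ((Quotient.congrRight hcoset).trans (Setoid.quotientKerEquivRange coset)).symm⟩

theorem exists_injective_cosets_inter (P : Presentation p V B K) {H H' : Set K}
    (hH : IsSubgroup H) (hH' : IsSubgroup H') :
    ∃ g : cosets (H ∩ H') → cosets H × cosets H', Function.Injective g := by
  obtain ⟨S, rfl⟩ := P.isSubgroup_iff.1 hH
  obtain ⟨T, rfl⟩ := P.isSubgroup_iff.1 hH'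
  rw [← Set.image_inter P.vec_injective, ← AddSubgroup.coe_inf]
  obtain ⟨e⟩ := P.nonempty_cosets_equiv S
  obtain ⟨e'⟩ := P.nonempty_cosets_equiv T
  obtain ⟨e''⟩ := P.nonempty_cosets_equiv (S ⊓ T)
  obtain ⟨g, hg⟩ := exists_injective_quotient_inf S T
  exact ⟨_, ((e.prodCongr e').symm.injective.comp hg).comp e''.injective⟩

/-- The subgroup of `K` that consists of the vectors orthogonal to `b`. -/
def perp (b : V) : Set K := P.vec '' (B b).toAddMonoidHom.ker

theorem vec_mem_perp_iff {b x : V} : P.vec x ∈ P.perp b ↔ B b x = 0 :=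
  P.vec_injective.mem_set_image

theorem mem_perp_iff {b : V} {k : K} : k ∈ P.perp b ↔ IsDot (P.vec b) k (P.scal 0) := by
  constructor
  · rintro ⟨x, hx, rfl⟩
    exact P.isDot_vec_iff.2 (congrArg P.scal (Eq.symm hx))
  · intro hk
    obtain ⟨-, x, -, rfl, -⟩ := (P.isDot_iff _ _ _).1 hk
    exact P.vec_mem_perp_iff.2 (P.scal_injective (P.isDot_vec_iff.1 hk)).symm

theorem isSubgroup_perp (b : V) : IsSubgroup (P.perp b) := P.isSubgroup_iff.2 ⟨_, rfl⟩

theorem exists_injective_cosets_perp (b : V) :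
    ∃ g : cosets (P.perp b) → ZMod p, Function.Injective g := by
  obtain ⟨e⟩ := P.nonempty_cosets_equiv (B b).toAddMonoidHom.ker
  exact ⟨_, (QuotientAddGroup.kerLift_injective (B b).toAddMonoidHom).comp e.injective⟩

theorem realize_iff_of_norm_eq [Fact p.Prime] (hB : ExtensionProperty B) {α β : Type*} [IsEmpty α]
    (φ : lang.Formula (α ⊕ β)) (u : α → K) {x y : V} (hx : x ≠ 0) (hy : y ≠ 0)
    (hxy : B x x = B y y) :
    φ.Realize (Sum.elim u fun _ => P.vec x) ↔ φ.Realize (Sum.elim u fun _ => P.vec y) := by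
  refine P.realize_formula_iff_of_sameTypeOver hB Submodule.fg_bot
    (sameTypeOver_toSpanSingleton hx hy hxy) φ (Sum.rec isEmptyElim fun _ => ?_)
    (Sum.rec isEmptyElim fun _ => ⟨1, 0, Submodule.zero_mem _, ?_⟩)
  · simp
  · simp

end

section Cardinality

variable {p : ℕ} {V : Type} [AddCommGroup V] [Module (ZMod p) V]
  {B : V →ₗ[ZMod p] V →ₗ[ZMod p] ZMod p} {K : Type} [lang.Structure K] (P : Presentation p V B K)

theorem mk_eq [NeZero p] [Infinite V] (P : Presentation p V B K) : #K = #V := by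
  rw [← mk_congr P.equiv, mk_sum, lift_id, lift_id]
  exact add_eq_left (aleph0_le_mk V) ((lt_aleph0_of_finite _).le.trans (aleph0_le_mk V))

theorem exists_image_eq_of_mk_cosets_lt {H : Set K} (hH : IsSubgroup H) (hlt : #(cosets H) < #V) :
    ∃ S : AddSubgroup V, H = P.vec '' S ∧ S ≠ ⊥ := by
  obtain ⟨S, rfl⟩ := P.isSubgroup_iff.1 hH
  obtain ⟨e⟩ := P.nonempty_cosets_equiv S
  exact ⟨S, rfl, ne_bot_of_mk_quotient_lt (mk_congr e ▸ hlt)⟩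

theorem exists_ne_zero_mem {H : Set K} (hH : IsSubgroup H) (hlt : #(cosets H) < #V) :
    ∃ x ≠ 0, P.vec x ∈ H := by
  obtain ⟨S, rfl, hS⟩ := P.exists_image_eq_of_mk_cosets_lt hH hlt
  obtain ⟨⟨x, hxS⟩, hx⟩ := S.ne_bot_iff_exists_ne_zero.1 hS
  exact ⟨x, fun h => hx (Subtype.ext h), x, hxS, rfl⟩

theorem isotropic_mem [Fact p.Prime] (hB : ExtensionProperty B) {H : Set K} (hH : IsSubgroup H)
    (hlt : #(cosets H) < #V)
    (hinv : ∀ x y, x ≠ 0 → y ≠ 0 → B x x = B y y → P.vec x ∈ H → P.vec y ∈ H) {w : V}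
    (hw : B w w = 0) : P.vec w ∈ H := by
  obtain ⟨S, rfl, hS⟩ := P.exists_image_eq_of_mk_cosets_lt hH hlt
  simp only [P.vec_injective.mem_set_image, SetLike.mem_coe] at hinv ⊢
  exact hB.isotropic_mem P.symm hS hinv hw

theorem vec_mem_finComponent_empty [Fact p.Prime] (hB : ExtensionProperty B) {w : V}
    (hw : B w w = 0) : P.vec w ∈ finComponent (∅ : Set K) := by
  rintro H ⟨hdef, hH, hfin⟩
  have := hB.infinite
  obtain ⟨φ, hφ⟩ := Set.definable_iff_exists_formula_sum.1 hdef
  have hmem (k : K) : k ∈ H ↔ φ.Realize (Sum.elim (fun a : (∅ : Set K) => (a : K)) fun _ => k) :=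
    Set.ext_iff.1 hφ fun _ => k
  refine P.isotropic_mem hB hH (hfin.lt_aleph0.trans_le (aleph0_le_mk V))
    (fun x y hx hy hxy hxH => ?_) hw
  rw [hmem] at hxH ⊢
  exact (P.realize_iff_of_norm_eq hB φ _ hx hy hxy).1 hxH

end Cardinality

section Embedding

variable {p : ℕ} {V W : Type*} [AddCommGroup V] [Module (ZMod p) V] [AddCommGroup W]
  [Module (ZMod p) W] {B : V →ₗ[ZMod p] V →ₗ[ZMod p] ZMod p}
  {C : W →ₗ[ZMod p] W →ₗ[ZMod p] ZMod p} {K K' : Type} [lang.Structure K] [lang.Structure K']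

theorem exists_map_vec (P : Presentation p V B K) (P' : Presentation p W C K')
    (f : K ↪ₑ[lang] K') (x : V) : ∃ y, f (P.vec x) = P'.vec y :=
  (P'.isVec_iff _).1 (((isElementary_isVec ()).iff_of_elementaryEmbedding f fun _ => P.vec x).2
    (P.isVec_vec x))

theorem map_vec_zero (P : Presentation p V B K) (P' : Presentation p W C K')
    (f : K ↪ₑ[lang] K') : f (P.vec 0) = P'.vec 0 :=
  (((isElementary_eq_zeroVec ()).iff_of_elementaryEmbedding f fun _ => P.vec 0).2
    P.zeroVec_eq.symm).trans P'.zeroVec_eq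

theorem isDot_map_iff (f : K ↪ₑ[lang] K') (k l m : K) : IsDot (f k) (f l) (f m) ↔ IsDot k l m :=
  (isElementary_isDot (0 : Fin 3) 1 2).iff_of_elementaryEmbedding f ![k, l, m]

theorem map_scal_zero (P : Presentation p V B K) (P' : Presentation p W C K')
    (f : K ↪ₑ[lang] K') : f (P.scal 0) = P'.scal 0 := by
  have h : IsDot (f (P.vec 0)) (f (P.vec 0)) (f (P.scal 0)) :=
    (isDot_map_iff f _ _ _).2 (P.isDot_vec_iff.2 (by simp))
  rw [P.map_vec_zero P', P'.isDot_vec_iff] at h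
  simpa using h

theorem exists_map_vec_isotropic (P : Presentation p V B K) (P' : Presentation p W C K')
    (f : K ↪ₑ[lang] K') {w : V} (hw : B w w = 0) : ∃ w', f (P.vec w) = P'.vec w' ∧ C w' w' = 0 := by
  obtain ⟨w', hw'⟩ := P.exists_map_vec P' f w
  have h := (isDot_map_iff f _ _ _).2 (P.mem_perp_iff.1 (P.vec_mem_perp_iff.2 hw))
  rw [hw', P.map_scal_zero P'] at h
  exact ⟨w', hw', P'.vec_mem_perp_iff.1 (P'.mem_perp_iff.2 h)⟩

end Embedding

end Presentation

theorem card_lang_le_aleph0 : lang.card ≤ ℵ₀ := by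
  let symbol : Fin 5 → lang.Symbols :=
    ![.inl ⟨0, Func.zero⟩, .inr ⟨1, Rel.vec⟩, .inr ⟨1, Rel.scal⟩, .inr ⟨3, Rel.add⟩,
      .inr ⟨3, Rel.dot⟩]
  have hsymbol : Function.Surjective symbol := by
    rintro (⟨_, ⟨⟩⟩ | ⟨_, ⟨⟩⟩)
    exacts [⟨0, rfl⟩, ⟨1, rfl⟩, ⟨2, rfl⟩, ⟨3, rfl⟩, ⟨4, rfl⟩]
  exact mk_le_aleph0_iff.2 hsymbol.countable

theorem exists_large_extension (p : ℕ) [Fact p.Prime] (N : Type) [lang.Structure N]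
    [hN : N ⊨ theory p] (κ : Cardinal.{0}) :
    ∃ (N' : Type) (_ : lang.Structure N') (_ : N ↪ₑ[lang] N') (V : Type) (_ : AddCommGroup V)
      (_ : Module (ZMod p) V) (B : V →ₗ[ZMod p] V →ₗ[ZMod p] ZMod p) (_ : Presentation p V B N'),
      N' ⊨ theory p ∧ ExtensionProperty B ∧ κ < #V := by
  obtain ⟨V, _, _, B, P, hB⟩ := exists_presentation p N
  have := hB.infinite
  have hNinf : Infinite N := .of_injective P.vec P.vec_injective
  let μ := Order.succ (max κ #N)
  have hNμ : #N ≤ μ := (le_max_right _ _).trans (Order.le_succ _)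
  obtain ⟨N', ⟨f⟩, hN'⟩ := exists_elementaryEmbedding_card_eq_of_ge lang N μ
    (by simpa using card_lang_le_aleph0.trans ((aleph0_le_mk N).trans hNμ)) (by simpa using hNμ)
  have hT : N' ⊨ theory p := (f.theory_model_iff (theory p)).1 hN
  obtain ⟨V', _, _, B', P', hB'⟩ := exists_presentation p N'
  have := hB'.infinite
  refine ⟨N', inferInstance, f, V', inferInstance, inferInstance, B', P', hT, hB', ?_⟩
  rw [← P'.mk_eq, hN']
  exact (le_max_left _ _).trans_lt (Order.lt_succ _)

section TypeDefinable

variable {N N' : Type} {A : Set N}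

theorem solutions_union [lang.Structure N'] (π ρ : Set (lang.Formula (A ⊕ Unit))) (f : N → N') :
    solutions (π ∪ ρ) f = solutions π f ∩ solutions ρ f := by
  ext x
  exact ⟨fun h => ⟨fun φ hφ => h φ (.inl hφ), fun φ hφ => h φ (.inr hφ)⟩,
    fun h φ hφ => hφ.elim (h.1 φ) (h.2 φ)⟩

/-- The partial type `π` with its parameters replaced by their images under `f`, as a partial type
over the whole structure `N'`. -/
def mapParams (π : Set (lang.Formula (A ⊕ Unit))) (f : N → N') :
    Set (lang.Formula ((Set.univ : Set N') ⊕ Unit)) :=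
  Formula.relabel (Sum.map (fun a : A => ⟨f a, trivial⟩) id) '' π

theorem solutions_mapParams (π : Set (lang.Formula (A ⊕ Unit))) (f : N → N')
    {M : Type} [lang.Structure M] (g : N' → M) :
    solutions (mapParams π f) g = solutions π (g ∘ f) := by
  ext x
  simp only [solutions, mapParams, Set.forall_mem_image, Formula.realize_relabel, Sum.elim_comp_map]
  rfl

variable [lang.Structure N]

theorem IsBoundedSubgroup.mapParams [lang.Structure N'] {π : Set (lang.Formula (A ⊕ Unit))}
    (hπ : IsBoundedSubgroup π) (f : N ↪ₑ[lang] N') : IsBoundedSubgroup (mapParams π f) := by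
  obtain ⟨κ, hκ⟩ := hπ
  refine ⟨κ, fun M _ g => ?_⟩
  rw [solutions_mapParams]
  exact hκ M (g.comp f)

theorem IsBoundedSubgroup.union {p : ℕ} [Fact p.Prime] [hN : N ⊨ theory p]
    {π ρ : Set (lang.Formula (A ⊕ Unit))} (hπ : IsBoundedSubgroup π) (hρ : IsBoundedSubgroup ρ) :
    IsBoundedSubgroup (π ∪ ρ) := by
  obtain ⟨κ, hκ⟩ := hπ
  obtain ⟨μ, hμ⟩ := hρ
  refine ⟨κ * μ, fun N' _ f => ?_⟩
  have hN' : N' ⊨ theory p := (f.theory_model_iff (theory p)).1 hN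
  obtain ⟨V, _, _, B, P, -⟩ := exists_presentation p N'
  obtain ⟨hπ, hπκ⟩ := hκ N' f
  obtain ⟨hρ, hρμ⟩ := hμ N' f
  obtain ⟨g, hg⟩ := P.exists_injective_cosets_inter hπ hρ
  rw [solutions_union]
  refine ⟨hπ.inter hρ, (mk_le_of_injective hg).trans ?_⟩
  rw [mk_prod, lift_id, lift_id]
  exact mul_le_mul' hπκ hρμ

end TypeDefinable

namespace Presentation

variable {p : ℕ} [Fact p.Prime] {V : Type*} [AddCommGroup V] [Module (ZMod p) V]
  {B : V →ₗ[ZMod p] V →ₗ[ZMod p] ZMod p} {K : Type} [lang.Structure K] (P : Presentation p V B K)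

theorem vec_mem_bddComponent_empty [K ⊨ theory p] {w : V} (hw : B w w = 0) :
    P.vec w ∈ bddComponent (∅ : Set K) := by
  rintro π ⟨κ, hκ⟩
  obtain ⟨K', _, f, V', _, _, B', P', -, hB', hV'⟩ := exists_large_extension p K κ
  obtain ⟨hsub, hindex⟩ := hκ K' f
  obtain ⟨w', hfw, hw'⟩ := P.exists_map_vec_isotropic P' f hw
  have hmem : P'.vec w' ∈ solutions π f :=
    P'.isotropic_mem hB' hsub (hindex.trans_lt hV')
      (fun x y hx hy hxy hxH φ hφ => (P'.realize_iff_of_norm_eq hB' φ _ hx hy hxy).1 (hxH φ hφ)) hw'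
  intro φ hφ
  rw [← f.map_formula, Sum.comp_elim]
  simpa [Function.comp_def, hfw] using hmem φ hφ

theorem exists_formula_perp {β : Type*} (i : β) (b : V) :
    ∃ χ : lang.Formula ((Set.univ : Set K) ⊕ β), ∀ (K' : Type) [lang.Structure K'] (f : K → K') v,
      χ.Realize (Sum.elim (fun a => f a) v) ↔ IsDot (f (P.vec b)) (v i) (f (P.scal 0)) := by
  obtain ⟨χ, hχ⟩ := isElementary_isDot (α := (Set.univ : Set K) ⊕ β) (.inl ⟨P.vec b, trivial⟩)
    (.inr i) (.inl ⟨P.scal 0, trivial⟩)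
  exact ⟨χ, fun K' _ f v => hχ K' _⟩

theorem exists_isBoundedSubgroup_perp [hK : K ⊨ theory p] (b : V) :
    ∃ ρ : Set (lang.Formula ((Set.univ : Set K) ⊕ Unit)),
      IsBoundedSubgroup ρ ∧ solutions ρ (id : K → K) = P.perp b := by
  obtain ⟨χ, hχ⟩ := P.exists_formula_perp () b
  have hsol {K' : Type} [lang.Structure K'] (f : K → K') :
      solutions {χ} f = {k | IsDot (f (P.vec b)) k (f (P.scal 0))} := by
    ext k
    simp only [solutions, Set.mem_singleton_iff, forall_eq]
    exact hχ K' f _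
  refine ⟨{χ}, ⟨#(ZMod p), fun K' _ f => ?_⟩, ?_⟩
  · have hK' : K' ⊨ theory p := (f.theory_model_iff (theory p)).1 hK
    obtain ⟨V', _, _, B', P', -⟩ := exists_presentation p K'
    obtain ⟨b', hb'⟩ := P.exists_map_vec P' f b
    obtain ⟨g, hg⟩ := P'.exists_injective_cosets_perp b'
    have hperp : solutions {χ} f = P'.perp b' := by
      rw [hsol, hb', P.map_scal_zero P' f]
      exact Set.ext fun k => P'.mem_perp_iff.symm
    rw [hperp]
    exact ⟨P'.isSubgroup_perp b', mk_le_of_injective hg⟩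
  · exact (hsol id).trans (Set.ext fun k => P.mem_perp_iff.symm)

theorem eq_zero_of_mem_finComponent_univ (hB : B.SeparatingRight) {w : V}
    (hw : P.vec w ∈ finComponent (Set.univ : Set K)) : w = 0 := by
  refine hB w fun b => P.vec_mem_perp_iff.1 (hw _ ⟨?_, P.isSubgroup_perp b, ?_⟩)
  · obtain ⟨χ, hχ⟩ := P.exists_formula_perp (0 : Fin 1) b
    exact Set.definable_iff_exists_formula_sum.2
      ⟨χ, Set.ext fun v => P.mem_perp_iff.trans (hχ K id v).symm⟩
  · obtain ⟨g, hg⟩ := P.exists_injective_cosets_perp b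
    exact Finite.of_injective g hg

theorem eq_zero_of_mem_bddComponent_univ [K ⊨ theory p] (hB : B.SeparatingRight) {w : V}
    (hw : P.vec w ∈ bddComponent (Set.univ : Set K)) : w = 0 := by
  refine hB w fun b => P.vec_mem_perp_iff.1 ?_
  obtain ⟨ρ, hρ, hρb⟩ := P.exists_isBoundedSubgroup_perp b
  exact hρb ▸ hw ρ hρ

end Presentation

theorem carrier_models_theory (p : ℕ) : Carrier p ⊨ theory p :=
  inferInstanceAs (Carrier p ⊨ lang.completeTheory (Carrier p))

variable (p : ℕ) [Fact p.Prime]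

theorem not_hasAbsoluteFinComponent : ¬ HasAbsoluteFinComponent (theory p) := by
  intro h
  have := carrier_models_theory p
  let P := standardPresentation p
  have hB := extensionProperty_bilinForm (p := p)
  obtain ⟨w, hw, hww⟩ := hB.exists_isotropic
  have hmem : P.vec w ∈ finComponent (Set.univ : Set (Carrier p)) :=
    h (Carrier p) Set.univ ▸ P.vec_mem_finComponent_empty hB hww
  exact hw (P.eq_zero_of_mem_finComponent_univ hB.separatingRight hmem)

theorem not_hasAbsoluteBddComponent : ¬ HasAbsoluteBddComponent (theory p) := by
  intro h
  have := carrier_models_theory p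
  let P := standardPresentation p
  have hB := extensionProperty_bilinForm (p := p)
  obtain ⟨w, hw, hww⟩ := hB.exists_isotropic
  have hmem : P.vec w ∈ bddComponent (Set.univ : Set (Carrier p)) :=
    h (Carrier p) Set.univ ▸ P.vec_mem_bddComponent_empty hww
  exact hw (P.eq_zero_of_mem_bddComponent_univ hB.separatingRight hmem)

theorem not_hasMinimalBddSubgroup : ¬ HasMinimalBddSubgroup (theory p) := by
  rintro ⟨N, _, _, A, π, hπ, hmin⟩
  obtain ⟨κ, hκ⟩ := id hπ
  obtain ⟨N', _, f, V, _, _, B, P, hN', hB, hV⟩ := exists_large_extension p N κ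
  obtain ⟨hsub, hindex⟩ := hκ N' f
  obtain ⟨x, hx, hxπ⟩ := P.exists_ne_zero_mem hsub (hindex.trans_lt hV)
  refine hx (hB.separatingRight x fun b => P.vec_mem_perp_iff.1 ?_)
  obtain ⟨ρ, hρ, hρb⟩ := P.exists_isBoundedSubgroup_perp b
  have hinter : solutions (mapParams π f ∪ ρ) (id : N' → N') = solutions π f ∩ P.perp b := by
    rw [solutions_union, solutions_mapParams, hρb, Function.id_comp]
  have heq := hmin N' f _ _ ((hπ.mapParams f).union (p := p) hρ)
    (hinter ▸ Set.inter_subset_left)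
  rw [hinter] at heq
  exact (heq.symm ▸ hxπ : P.vec x ∈ solutions π f ∩ P.perp b).2

end Subgroups

end BilinearSpace

theorem mainTheorem4 (p : ℕ) [Fact p.Prime] :
    ModelDividing.IsDependent 2 (BilinearSpace.theory p) ∧
    ModelDividing.IsSimpleTheory (BilinearSpace.theory p) ∧
    ModelDividing.HasIP 1 (BilinearSpace.theory p) ∧
    ¬ BilinearSpace.HasAbsoluteFinComponent (BilinearSpace.theory p) ∧
    ¬ BilinearSpace.HasAbsoluteBddComponent (BilinearSpace.theory p) ∧
    ¬ BilinearSpace.HasMinimalBddSubgroup (BilinearSpace.theory p) := by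
  exact ⟨BilinearSpace.isDependent_two p, BilinearSpace.isSimpleTheory p, BilinearSpace.hasIP_one p,
    BilinearSpace.not_hasAbsoluteFinComponent p, BilinearSpace.not_hasAbsoluteBddComponent p,
    BilinearSpace.not_hasMinimalBddSubgroup p⟩
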